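/- Let $n\ge 0$, let $f:[0,\infty)\to\mathbf R$ be smooth and bounded above, and put $V(x)=f(|x|^2/2)$ on $\mathbf R^n$. For $\varepsilon>0$ let $$L_\varepsilon(x,v)=\tfrac12|v|^2-\varepsilon V(x),\qquad c_\varepsilon(x,y)=\inf_\gamma\int_0^1 L_\varepsilon(\gamma(t),\dot\gamma(t))\,dt,$$ the infimum being over smooth curves $\gamma:[0,1]\to\mathbf R^n$ with $\gamma(0)=x$, $\gamma(1)=y$. Identify tangent and cotangent vectors through the Euclidean metric, and let $\Phi^\varepsilon_t(x,\alpha)$ be the position at time $t$ of the Hamiltonian flow of $\frac12|p|^2+\varepsilon V(q)$ started at $(x,\alpha)$. A covector $(x,\alpha)$ is *regular* if its trajectory exists for $t\in[0,1]$ and $t\mapsto\Phi^\varepsilon_t(x,\alpha)$, $t\in[0,1]$, is the unique path of least action between its endpoints; it is in the *conjugate locus* if the differential of $\Phi^\varepsilon_1(x,\cdot)$ at $\alpha$ is not of full rank. For a cost $c$ and a set $\mathcal O\subseteq\mathbf R^n\times\mathbf R^n$, let $\exp^c(x,\alpha)$, defined whenever $\alpha=-d_xc(x,y)$ for some $y$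 with $(x,y)\in\mathcal O$, be such a point $y$. The cross-curvature is $$\mathcal C_x(u,\alpha,\alpha_1)=-\tfrac32\,\partial_s^2\partial_t^2\,c\big(\gamma(t),\exp^c(x,\alpha+s\alpha_1)\big)\Big|_{s=t=0},$$ where $\gamma$ is any smooth curve with $\gamma(0)=x$, $\dot\gamma(0)=u$. We say that $c$ satisfies **(A3s)** on $\mathcal O$ if $\mathcal O$ is open; $c$ is $C^4$ on $\mathcal O$; $y\mapsto d_xc(x,y)$ is injective on $\{y:(x,y)\in\mathcal O\}$ for every $x$; $d_yd_xc(x,y)$ is injective for all $(x,y)\in\mathcal O$; and for all $(x,\alpha)$ in the domain of $\exp^c$ and all $u,\alpha_1$ with $\alpha_1(u)=0$ one has $\mathcal C_x(u,\alpha,\alpha_1)\ge 0$ (for every choice of $\gamma$), with equality only if $u=0$ or $\alpha_1=0$. **(a)** Let $U\subset T\mathbf R^n=\mathbf R^n\times\mathbf R^n$ be a bounded open set and $C>0$ a constant such that $$f''\big(\tfrac{|x+tv|^2}{2}\big)\ge C,\qquad f'''\big(\tfrac{|x+tv|^2}{2}\big)\ge 0,\qquad f^{(4)}\big(\tfrac{|x+tv|^2}{2}\big)\ge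 0\qquad\text{for all }(x,v)\in U,\ t\in[0,1].$$ Then there is $\varepsilon_0>0$ such that for every $\varepsilon\in(0,\varepsilon_0)$ and every open set $U_\varepsilon$ of covectors that are regular and outside the conjugate locus, $c_\varepsilon$ satisfies (A3s) on $$\mathcal K_\varepsilon=\{(x,\Phi^\varepsilon_1(x,\alpha)) : (x,\alpha)\in U_\varepsilon\cap U\}.$$ **(b)** (Anharmonic oscillator.) In particular, let $K>0$ and suppose that $f$ (smooth and bounded above on $[0,\infty)$) satisfies $f(s)=s^2$ for $0\le s\le K^2/2$. Then the conclusion of (a) holds with $U=\{(x,v):|x|+|v|<K\}$. -/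

import Mathlib

open Set
open scoped ContDiff

noncomputable section

namespace MechMTW

/-- Euclidean space `ℝⁿ`. Its tangent and cotangent bundles are both identified, through the
Euclidean metric, with `E n × E n`. -/
abbrev E (n : ℕ) : Type := EuclideanSpace ℝ (Fin n)

variable {n : ℕ}

/-! ### Curves, action and cost of the Lagrangian `L(x, v) = |v|² / 2 - V(x)` -/

/-- Smooth curves `γ : [0,1] → ℝⁿ` from `x` to `y`; values of `γ` outside `[0,1]` are irrelevant. -/
def curves (x y : E n) : Set (ℝ → E n) :=
  {γ | ContDiffOn ℝ ∞ γ (Icc 0 1) ∧ γ 0 = x ∧ γ 1 = y}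

/-- The natural mechanical Lagrangian with potential `V`. -/
def lagrangian (V : E n → ℝ) (x v : E n) : ℝ := ‖v‖ ^ 2 / 2 - V x

/-- The action of a curve over the time interval `[0,1]`. -/
def action (V : E n → ℝ) (γ : ℝ → E n) : ℝ :=
  ∫ t in (0 : ℝ)..1, lagrangian V (γ t) (derivWithin γ (Icc 0 1) t)

/-- The cost: the infimum of the action over smooth curves from `x` to `y`. (When `V` is smooth and
bounded above the set of actions is nonempty and bounded below.) -/
def cost (V : E n → ℝ) (x y : E n) : ℝ := sInf (action V '' curves x y)

/-- `γ` is a path of least action from `x` to `y`. -/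
def IsLeastAction (V : E n → ℝ) (x y : E n) (γ : ℝ → E n) : Prop :=
  γ ∈ curves x y ∧ ∀ η ∈ curves x y, action V γ ≤ action V η

/-! ### Hamiltonian flow, regular covectors and the conjugate locus -/

/-- The Hamiltonian `|p|² / 2 + V(x)`. -/
def hamiltonian (V : E n → ℝ) (z : E n × E n) : ℝ := ‖z.2‖ ^ 2 / 2 + V z.1

/-- The Hamiltonian vector field `(∂H/∂p, -∂H/∂q)`. -/
def hamiltonianField (H : E n × E n → ℝ) (z : E n × E n) : E n × E n :=
  (gradient (fun p => H (z.1, p)) z.2, -gradient (fun q => H (q, z.2)) z.1)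

/-- `σ` is an integral curve of the Hamiltonian vector field of `H` on `[0,T]` with `σ 0 = z`. -/
def IsFlowLine (H : E n × E n → ℝ) (T : ℝ) (z : E n × E n) (σ : ℝ → E n × E n) : Prop :=
  σ 0 = z ∧ ∀ t ∈ Icc 0 T, HasDerivWithinAt σ (hamiltonianField H (σ t)) (Icc 0 T) t

open Classical in
/-- The Hamiltonian flow for times `t ≥ 0`, with the dummy value `z` if the solution that starts
at `z` does not exist up to time `t`. -/
def flow (H : E n × E n → ℝ) (t : ℝ) (z : E n × E n) : E n × E n :=
  if h : ∃ σ, IsFlowLine H t z σ then h.choose t else z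

/-- `Φ_t`, the position component of the Hamiltonian flow of `|p|² / 2 + V(x)`. -/
def Phi (V : E n → ℝ) (t : ℝ) (z : E n × E n) : E n := (flow (hamiltonian V) t z).1

/-- The covector `z` is regular: its Hamiltonian trajectory exists on `[0,1]`, and
`t ∈ [0,1] ↦ Φ_t(z)` is the unique path of least action between its endpoints. -/
def IsRegular (V : E n → ℝ) (z : E n × E n) : Prop :=
  (∃ σ, IsFlowLine (hamiltonian V) 1 z σ) ∧
  IsLeastAction V z.1 (Phi V 1 z) (fun t => Phi V t z) ∧
  ∀ γ, IsLeastAction V z.1 (Phi V 1 z) γ → EqOn γ (fun t => Phi V t z) (Icc 0 1)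

/-- The covector `z = (x, α)` is in the conjugate locus: the differential of `Φ₁(x, ·)` at `α` does
not have full rank. -/
def IsConjugate (V : E n → ℝ) (z : E n × E n) : Prop :=
  ¬ Function.Injective (fderiv ℝ (fun α => Phi V 1 (z.1, α)) z.2)

/-! ### Cross-curvature and the strong Ma-Trudinger-Wang condition -/

/-- The differential `d_x c(x, y)`, as a vector. -/
def gradX (c : E n → E n → ℝ) (x y : E n) : E n := gradient (fun x' => c x' y) x

/-- The `c`-exponential map: `cExp c O x α` is the point `y` with `(x, y) ∈ O` and
`d_x c(x, y) = -α`. -/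
def cExp (c : E n → E n → ℝ) (O : Set (E n × E n)) (x α : E n) : E n :=
  Function.invFunOn (gradX c x) {y | (x, y) ∈ O} (-α)

/-- The domain of the `c`-exponential map: all `(x, -d_x c(x, y))` with `(x, y) ∈ O`. -/
def cExpDomain (c : E n → E n → ℝ) (O : Set (E n × E n)) : Set (E n × E n) :=
  {z | ∃ y, (z.1, y) ∈ O ∧ z.2 = -gradX c z.1 y}

/-- The cross-curvature `𝒞_x(u, α, α₁) = -3/2 ∂_s² ∂_t² c(γ(t), exp^c(x, α + s α₁))` at `s = t = 0`,
where `x = γ(0)`, `u = γ'(0)`, computed with the curve `γ`. -/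
def crossCurvature (c : E n → E n → ℝ) (O : Set (E n × E n)) (γ : ℝ → E n) (α α₁ : E n) : ℝ :=
  -(3 / 2) * iteratedDeriv 2
    (fun s : ℝ => iteratedDeriv 2 (fun t : ℝ => c (γ t) (cExp c O (γ 0) (α + s • α₁))) 0) 0

/-- The conditions (A0), (A1), (A2) under which the curvature conditions are considered:
`O` is open, `c` is `C⁴` on `O`, `y ↦ d_x c(x, y)` is injective on each fibre of `O`,
and the mixed second derivative `d_y d_x c(x, y)` is injective at each point of `O`. -/
structure Nondegenerate (c : E n → E n → ℝ) (O : Set (E n × E n)) : Prop where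
  isOpen : IsOpen O
  a0 : ContDiffOn ℝ 4 (fun z : E n × E n => c z.1 z.2) O
  a1 : ∀ x, InjOn (gradX c x) {y | (x, y) ∈ O}
  a2 : ∀ x y, (x, y) ∈ O → Function.Injective (fderiv ℝ (gradX c x) y)

/-- The strong Ma-Trudinger-Wang condition (A3s) on `O` (together with (A0)-(A2)): for every
covector `(x, α)` in the domain of `exp^c`, every `α₁` and every `u` with `α₁(u) = 0`, the
curvature is nonnegative, and it vanishes only if `u = 0` or `α₁ = 0`. The vector `u` is given as
the velocity of an arbitrary smooth curve `γ` through `x`, so that the curvature may be computed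
with any such curve. -/
structure StrongMTW (c : E n → E n → ℝ) (O : Set (E n × E n)) : Prop where
  nondegenerate : Nondegenerate c O
  nonneg : ∀ γ : ℝ → E n, ContDiff ℝ ∞ γ → ∀ α α₁ : E n, (γ 0, α) ∈ cExpDomain c O →
    inner ℝ α₁ (deriv γ 0) = 0 → 0 ≤ crossCurvature c O γ α α₁
  eq_zero : ∀ γ : ℝ → E n, ContDiff ℝ ∞ γ → ∀ α α₁ : E n, (γ 0, α) ∈ cExpDomain c O →
    inner ℝ α₁ (deriv γ 0) = 0 → crossCurvature c O γ α α₁ = 0 → deriv γ 0 = 0 ∨ α₁ = 0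

/-! ### Perturbation by a radial potential -/

/-- The radial potential `ε f(|x|² / 2)`. -/
def radial (ε : ℝ) (f : ℝ → ℝ) (x : E n) : ℝ := ε * f (‖x‖ ^ 2 / 2)

/-- The set `{(x, Φ₁(x, α)) | (x, α) ∈ W}`. -/
def endpoints (V : E n → ℝ) (W : Set (E n × E n)) : Set (E n × E n) :=
  (fun z => (z.1, Phi V 1 z)) '' W

/-- For all small `ε > 0`, and every open set `Uε` of covectors that are regular and outside the
conjugate locus for `|v|² / 2 - ε f(|x|² / 2)`, the cost of this Lagrangian satisfies (A3s) on
`{(x, Φ₁(x, α)) | (x, α) ∈ Uε ∩ U}`. -/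
def PerturbedStrongMTW (f : ℝ → ℝ) (U : Set (E n × E n)) : Prop :=
  ∃ ε₀ > 0, ∀ ε : ℝ, 0 < ε → ε < ε₀ → ∀ Uε : Set (E n × E n), IsOpen Uε →
    (∀ z ∈ Uε, IsRegular (radial ε f) z ∧ ¬ IsConjugate (radial ε f) z) →
    StrongMTW (cost (radial (n := n) ε f)) (endpoints (radial ε f) (Uε ∩ U))

end MechMTW

end

/-! For `ε = 0` the cost is `|x - y|² / 2`, whose cross-curvature vanishes, so the sign for small
`ε` is decided by the first-order term in `ε`. The endpoint of a trajectory is `Φ(x, α) = x + α - ε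
R(x, α)`, where `R` is the double time integral of `∇V` along it. Regularity gives `d_x c(x, Φ(x,
α)) = -α`; differentiating this identity shows that the Hessian of `c` in `x` is `(∂_α Φ)⁻¹ ∂_x Φ =
id - ε B`, with `B = (id - ε R_α)⁻¹ (R_x - R_α)`. Hence the cross-curvature is exactly `(3/2) ε`
times the second derivative of `⟨B u, u⟩` in `α` along `α₁` (`crossCurvature_eq_curvatureForm`).

At `ε = 0` trajectories are straight lines, and that second derivative is `∫₀¹ ∫₀ᵗ (1 - s) s² D⁴V(x
+ s α)(u, u, α₁, α₁) ds dt` (`inner_curvatureOp_zero`, `curvatureForm_zero_pos`). For radial `V` and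
`u ⟂ α₁` the integrand is positive under the sign conditions on `f` (`fourthDeriv_radial`).
Positivity survives for small `ε` because the form is continuous at `ε = 0` and, by homogeneity, has
to be checked only over the compact closure of `U` and orthonormal pairs
(`exists_pos_forall_curvatureForm_pos`).

The required smooth dependence on `(ε, x, α)` comes from the implicit function theorem in `C([0,1],
ℝⁿ)`, applied to Newton's equation in integrated form (`exists_local_newton`). -/

namespace MechMTW

open Topology MeasureTheory Filter

/-! ### Smoothness of superposition operators on spaces of continuous functions -/

section Superposition

variable {K F G : Type} [TopologicalSpace K] [CompactSpace K]
  [NormedAddCommGroup F] [NormedSpace ℝ F] [NormedAddCommGroup G] [NormedSpace ℝ G]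

/-- Pointwise application of a continuous family of operators to a continuous function. -/
noncomputable def pointwiseApply (K F G : Type) [TopologicalSpace K] [CompactSpace K]
    [NormedAddCommGroup F] [NormedSpace ℝ F] [NormedAddCommGroup G] [NormedSpace ℝ G] :
    C(K, F →L[ℝ] G) →L[ℝ] C(K, F) →L[ℝ] C(K, G) :=
  LinearMap.mkContinuous₂
    (LinearMap.mk₂ ℝ (fun (A : C(K, F →L[ℝ] G)) (h : C(K, F)) =>
        (⟨fun x => A x (h x), by fun_prop⟩ : C(K, G)))
      (fun _ _ _ => by ext; simp) (fun _ _ _ => by ext; simp)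
      (fun _ _ _ => by ext; simp) (fun _ _ _ => by ext; simp)) 1 (by
    intro A h
    rw [ContinuousMap.norm_le _ (by positivity)]
    intro x
    calc ‖A x (h x)‖ ≤ ‖A x‖ * ‖h x‖ := (A x).le_opNorm _
      _ ≤ ‖A‖ * ‖h‖ := by
        gcongr
        · exact A.norm_coe_le_norm x
        · exact h.norm_coe_le_norm x
      _ = 1 * ‖A‖ * ‖h‖ := by ring)

@[simp] theorem pointwiseApply_apply (A : C(K, F →L[ℝ] G)) (h : C(K, F)) (x : K) :
    pointwiseApply K F G A h x = A x (h x) := rfl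

/-- The mean value inequality on balls around the points `q x`. The radius is uniform in `x` because
`f'` is uniformly continuous near the compact range of `q`; `F` itself need not be locally compact.
-/
theorem hasFDerivAt_superposition (f : C(F, G)) (f' : C(F, F →L[ℝ] G))
    (hf : ∀ x, HasFDerivAt f (f' x) x) (q : C(K, F)) :
    HasFDerivAt (fun q : C(K, F) => f.comp q) (pointwiseApply K F G (f'.comp q)) q := by
  refine HasFDerivAt.of_isLittleO ?_
  rw [Asymptotics.isLittleO_iff]
  intro c hc
  have hU := (isCompact_range q.continuous).uniformContinuousAt_of_continuousAt f'
    (fun a _ => f'.continuous.continuousAt) (Metric.dist_mem_uniformity hc)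
  obtain ⟨δ, hδ, hδU⟩ := Metric.mem_uniformity_dist.1 hU
  filter_upwards [Metric.ball_mem_nhds q hδ] with r hr
  rw [ContinuousMap.norm_le _ (by positivity)]
  intro x
  have hx : r x ∈ Metric.ball (q x) δ :=
    lt_of_le_of_lt (ContinuousMap.dist_apply_le_dist x) hr
  have := (convex_ball (q x) δ).norm_image_sub_le_of_norm_hasFDerivWithin_le'
    (f := f) (f' := fun y => f' y) (φ := f' (q x)) (C := c)
    (fun y _ => (hf y).hasFDerivWithinAt)
    (fun y hy => by
      have h1 : dist (q x) y < δ := by rw [dist_comm]; exact hy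
      have h2 : dist (f' (q x)) (f' y) < c := hδU h1 (mem_range_self x)
      rw [← dist_eq_norm, dist_comm]
      exact h2.le)
    (Metric.mem_ball_self hδ) hx
  calc _ = ‖f (r x) - f (q x) - f' (q x) (r x - q x)‖ := rfl
    _ ≤ c * ‖r x - q x‖ := this
    _ ≤ c * ‖r - q‖ := by
      gcongr
      exact (r - q).norm_coe_le_norm x

/-- The derivative is again a superposition operator, that of `f'`, followed by a bounded linear
map. The target changes to `F →L[ℝ] G`, so the induction is over all `G`. -/
theorem contDiff_superposition_nat (n : ℕ) : ∀ {G : Type} [NormedAddCommGroup G] [NormedSpace ℝ G]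
    (f : C(F, G)), ContDiff ℝ n f → ContDiff ℝ n (fun q : C(K, F) => f.comp q) := by
  induction n with
  | zero =>
    intro G _ _ f _
    exact contDiff_zero.2 (ContinuousMap.continuous_postcomp f)
  | succ n ih =>
    intro G _ _ f hf
    have hf' : ContDiff ℝ ((n : ℕ∞ω) + 1) f := by exact_mod_cast hf
    rw [contDiff_succ_iff_fderiv] at hf'
    let f' : C(F, F →L[ℝ] G) := ⟨fderiv ℝ f, hf'.2.2.continuous⟩
    have hd := hasFDerivAt_superposition (K := K) f f' (fun x => (hf'.1 x).hasFDerivAt)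
    have : ContDiff ℝ ((n : ℕ∞ω) + 1) (fun q : C(K, F) => f.comp q) := by
      rw [contDiff_succ_iff_fderiv]
      refine ⟨fun q => (hd q).differentiableAt, by simp, ?_⟩
      have he : fderiv ℝ (fun q : C(K, F) => f.comp q) =
          fun q => pointwiseApply K F G (f'.comp q) := funext fun q => (hd q).fderiv
      rw [he]
      exact (pointwiseApply K F G).contDiff.comp (ih f' hf'.2.2)
    exact_mod_cast this

theorem contDiff_superposition (f : C(F, G)) (hf : ContDiff ℝ ∞ f) :
    ContDiff ℝ ∞ (fun q : C(K, F) => f.comp q) :=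
  contDiff_infty.2 fun n => contDiff_superposition_nat n f (contDiff_infty.1 hf n)

end Superposition

/-! ### Integration over `[0,1]` as a bounded operator -/

section Integral

variable {F : Type} [NormedAddCommGroup F]

/-- The unit interval, as a subtype. -/
abbrev I01 : Type := Icc (0 : ℝ) 1

/-- Extension of a continuous function on `[0,1]` to the line. -/
noncomputable abbrev ext01 (φ : C(I01, F)) : ℝ → F := IccExtend (zero_le_one (α := ℝ)) φ

theorem continuous_ext01 (φ : C(I01, F)) : Continuous (ext01 φ) := φ.continuous.Icc_extend'

theorem ext01_of_mem (φ : C(I01, F)) {t : ℝ} (ht : t ∈ Icc (0 : ℝ) 1) : ext01 φ t = φ ⟨t, ht⟩ :=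
  IccExtend_of_mem _ _ ht

theorem ext01_coe (φ : C(I01, F)) (t : I01) : ext01 φ t = φ t := ext01_of_mem φ t.2

theorem norm_ext01_le (φ : C(I01, F)) (t : ℝ) : ‖ext01 φ t‖ ≤ ‖φ‖ := φ.norm_coe_le_norm _

variable [NormedSpace ℝ F] [CompleteSpace F]

theorem hasDerivAt_integral_ext01 (φ : C(I01, F)) (t : ℝ) :
    HasDerivAt (fun t => ∫ s in (0 : ℝ)..t, ext01 φ s) (ext01 φ t) t :=
  intervalIntegral.integral_hasDerivAt_right ((continuous_ext01 φ).intervalIntegrable _ _)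
    ((continuous_ext01 φ).stronglyMeasurableAtFilter _ _) (continuous_ext01 φ).continuousAt

/-- The primitive that vanishes at `0`, as an operator on continuous functions on `[0,1]`. -/
noncomputable def primitive (F : Type) [NormedAddCommGroup F] [NormedSpace ℝ F] [CompleteSpace F] :
    C(I01, F) →L[ℝ] C(I01, F) :=
  LinearMap.mkContinuous
    { toFun := fun φ => ⟨fun t => ∫ s in (0 : ℝ)..t, ext01 φ s, by
        have : Continuous (fun t => ∫ s in (0 : ℝ)..t, ext01 φ s) :=
          continuous_iff_continuousAt.2 fun t => (hasDerivAt_integral_ext01 φ t).continuousAt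
        exact this.comp continuous_subtype_val⟩
      map_add' := fun φ ψ => by
        ext t
        exact intervalIntegral.integral_add ((continuous_ext01 φ).intervalIntegrable _ _)
          ((continuous_ext01 ψ).intervalIntegrable _ _)
      map_smul' := fun c φ => by
        ext t
        exact intervalIntegral.integral_smul c _ } 1 (by
    intro φ
    rw [ContinuousMap.norm_le _ (by positivity)]
    intro t
    have h := intervalIntegral.norm_integral_le_of_norm_le_const (a := 0) (b := (t : ℝ))
      (f := ext01 φ) (C := ‖φ‖) (fun s _ => norm_ext01_le φ s)
    refine h.trans ?_
    rw [sub_zero, abs_of_nonneg t.2.1, one_mul]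
    exact mul_le_of_le_one_right (norm_nonneg _) t.2.2)

theorem primitive_apply (φ : C(I01, F)) (t : I01) :
    primitive F φ t = ∫ s in (0 : ℝ)..t, ext01 φ s := rfl

theorem primitive_zero (φ : C(I01, F)) : primitive F φ 0 = 0 := by
  simp [primitive_apply]

theorem hasDerivWithinAt_ext01_primitive (φ : C(I01, F)) {t : ℝ} (ht : t ∈ Icc (0 : ℝ) 1) :
    HasDerivWithinAt (ext01 (primitive F φ)) (ext01 φ t) (Icc 0 1) t := by
  refine (hasDerivAt_integral_ext01 φ t).hasDerivWithinAt.congr_of_mem (fun s hs => ?_) ht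
  rw [ext01_of_mem _ hs, primitive_apply]

/-- `φ ↦ ∫₀¹ φ`, as a continuous linear map. -/
noncomputable def integral01 (F : Type) [NormedAddCommGroup F] [NormedSpace ℝ F]
    [CompleteSpace F] : C(I01, F) →L[ℝ] F :=
  (ContinuousMap.evalCLM ℝ (⟨1, by simp⟩ : I01)).comp (primitive F)

theorem integral01_apply (φ : C(I01, F)) : integral01 F φ = ∫ s in (0 : ℝ)..1, ext01 φ s := rfl

theorem primitive_one (φ : C(I01, F)) : primitive F φ ⟨1, by simp⟩ = integral01 F φ := rfl

end Integral

/-! ### Newton's equation as an equation in a Banach space -/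

section Newton

variable {n : ℕ}

/-- The path `t ↦ x + t α`. -/
noncomputable def affinePath (n : ℕ) : E n × E n →L[ℝ] C(I01, E n) :=
  (ContinuousLinearMap.const ℝ I01).comp (ContinuousLinearMap.fst ℝ (E n) (E n)) +
    (primitive (E n)).comp ((ContinuousLinearMap.const ℝ I01).comp
      (ContinuousLinearMap.snd ℝ (E n) (E n)))

theorem affinePath_eq (z : E n × E n) : affinePath n z =
    ContinuousMap.const I01 z.1 + primitive (E n) (ContinuousMap.const I01 z.2) := rfl

theorem affinePath_apply (z : E n × E n) (t : I01) : affinePath n z t = z.1 + (t : ℝ) • z.2 := by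
  have : ∀ s, ext01 (ContinuousMap.const I01 z.2) s = z.2 := fun s => rfl
  simp [affinePath_eq, primitive_apply, this]

/-- Newton's equation `q'' = -ε g(q)`, `(q, q')(0) = z` in integrated form, with `p = (ε, z)`. -/
def IsNewton (g : C(E n, E n)) (p : ℝ × (E n × E n)) (q : C(I01, E n)) : Prop :=
  q = affinePath n p.2 - p.1 • primitive (E n) (primitive (E n) (g.comp q))

/-- The momentum `q'` of a solution `q` of Newton's equation. -/
noncomputable def momentum (g : C(E n, E n)) (p : ℝ × (E n × E n)) (q : C(I01, E n)) :
    C(I01, E n) :=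
  ContinuousMap.const I01 p.2.2 - p.1 • primitive (E n) (g.comp q)

theorem isNewton_iff {g : C(E n, E n)} {p : ℝ × (E n × E n)} {q : C(I01, E n)} :
    IsNewton g p q ↔ q = ContinuousMap.const I01 p.2.1 + primitive (E n) (momentum g p q) := by
  rw [IsNewton, momentum, map_sub, map_smul, affinePath_eq, add_sub_assoc]

theorem isNewton_zero (g : C(E n, E n)) (z : E n × E n) : IsNewton g (0, z) (affinePath n z) := by
  simp [IsNewton]

/-- The nonlinear term carries the factor `ε`, so at `ε = 0` the partial derivative in `q` is the
identity and the implicit function theorem applies at every straight line. -/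
theorem exists_local_newton (g : C(E n, E n)) (hg : ContDiff ℝ ∞ g) (z₀ : E n × E n) :
    ∃ Q : ℝ × (E n × E n) → C(I01, E n), ContDiffAt ℝ ∞ Q (0, z₀) ∧
      ∀ᶠ p in 𝓝 (0, z₀), IsNewton g p (Q p) := by
  let f : (ℝ × (E n × E n)) × C(I01, E n) → C(I01, E n) := fun u =>
    u.2 - affinePath n u.1.2 + u.1.1 • primitive (E n) (primitive (E n) (g.comp u.2))
  have hs := contDiff_superposition (K := I01) g hg
  have hf : ContDiff ℝ ∞ f := by
    refine (contDiff_snd.sub ((affinePath n).contDiff.comp contDiff_fst.snd)).add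
      (contDiff_fst.fst.smul ?_)
    exact (primitive (E n)).contDiff.comp ((primitive (E n)).contDiff.comp (hs.comp contDiff_snd))
  let u : (ℝ × (E n × E n)) × C(I01, E n) := ((0, z₀), affinePath n z₀)
  have hid : fderiv ℝ f u ∘L .inr ℝ (ℝ × (E n × E n)) C(I01, E n) = .id ℝ _ := by
    have h1 : HasFDerivAt (fun q : C(I01, E n) => f ((0, z₀), q))
        (fderiv ℝ f u ∘L .inr ℝ (ℝ × (E n × E n)) C(I01, E n)) (affinePath n z₀) :=
      ((hf.differentiable (by simp)) u).hasFDerivAt.comp (affinePath n z₀)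
        (hasFDerivAt_prodMk_right (0, z₀) (affinePath n z₀))
    have h2 : HasFDerivAt (fun q : C(I01, E n) => f ((0, z₀), q)) (.id ℝ _) (affinePath n z₀) := by
      have : (fun q : C(I01, E n) => f ((0, z₀), q)) = fun q => q - affinePath n z₀ := by
        funext q; simp [f]
      rw [this]
      exact (hasFDerivAt_id _).sub_const _
    exact h1.unique h2
  have hinv : (fderiv ℝ f u ∘L .inr ℝ (ℝ × (E n × E n)) C(I01, E n)).IsInvertible := by
    rw [hid]
    exact ContinuousLinearMap.isInvertible_equiv (f := ContinuousLinearEquiv.refl ℝ _)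
  have hfu : ContDiffAt ℝ ∞ f u := hf.contDiffAt
  refine ⟨hfu.implicitFunction (by simp) hinv, hfu.contDiffAt_implicitFunction (by simp) hinv, ?_⟩
  filter_upwards [hfu.eventually_apply_implicitFunction (by simp) hinv] with p hp
  have h0 : f u = 0 := by simp [f, u]
  rw [h0] at hp
  rw [IsNewton, ← sub_eq_zero, ← hp]
  simp only [f]
  abel

end Newton

/-! ### Uniqueness for the Hamiltonian flow and its identification with Newton's equation -/

section Flow

variable {n : ℕ} {V : E n → ℝ}

theorem contDiff_gradient (hV : ContDiff ℝ ∞ V) : ContDiff ℝ ∞ (gradient V) :=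
  (InnerProductSpace.toDual ℝ (E n)).symm.contDiff.comp (hV.fderiv_right (by simp))

theorem hasGradientAt_of_contDiff (hV : ContDiff ℝ ∞ V) (x : E n) :
    HasGradientAt V (gradient V x) x :=
  (hV.differentiable (by simp) x).hasGradientAt

/-- The gradient of a smooth function, as a continuous map. -/
noncomputable def gradientMap (V : E n → ℝ) (hV : ContDiff ℝ ∞ V) : C(E n, E n) :=
  ⟨gradient V, (contDiff_gradient hV).continuous⟩

theorem hamiltonianField_scaled (hV : ContDiff ℝ ∞ V) (ε : ℝ) (z : E n × E n) :
    hamiltonianField (hamiltonian fun x => ε * V x) z = (z.2, -(ε • gradient V z.1)) := by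
  have h1 : HasGradientAt (fun p : E n => hamiltonian (fun x => ε * V x) (z.1, p)) z.2 z.2 := by
    rw [hasGradientAt_iff_hasFDerivAt]
    have := (((hasStrictFDerivAt_norm_sq z.2).hasFDerivAt.mul_const (1 / 2 : ℝ)).add_const
      (ε * V z.1))
    refine (this.congr_fderiv ?_).congr_of_eventuallyEq (Eventually.of_forall fun p => ?_)
    · ext v; simp
    · simp [hamiltonian, div_eq_mul_inv]
  have h2 : HasGradientAt (fun q : E n => hamiltonian (fun x => ε * V x) (q, z.2))
      (ε • gradient V z.1) z.1 := by
    rw [hasGradientAt_iff_hasFDerivAt]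
    have := ((hasGradientAt_of_contDiff hV z.1).hasFDerivAt.const_mul ε).const_add (‖z.2‖ ^ 2 / 2)
    refine this.congr_fderiv ?_
    ext v; simp
  rw [hamiltonianField, h1.gradient, h2.gradient]

/-- The field is only locally Lipschitz; a ball containing both compact trajectories supplies the
constant for Grönwall's inequality. -/
theorem IsFlowLine.eqOn (hV : ContDiff ℝ ∞ V) {ε T : ℝ} {z : E n × E n}
    {σ τ : ℝ → E n × E n} (hσ : IsFlowLine (hamiltonian fun x => ε * V x) T z σ)
    (hτ : IsFlowLine (hamiltonian fun x => ε * V x) T z τ) : EqOn σ τ (Icc 0 T) := by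
  have hcσ : ContinuousOn σ (Icc 0 T) := fun t ht => (hσ.2 t ht).continuousWithinAt
  have hcτ : ContinuousOn τ (Icc 0 T) := fun t ht => (hτ.2 t ht).continuousWithinAt
  obtain ⟨r, hr⟩ := ((isCompact_Icc.image_of_continuousOn hcσ).union
    (isCompact_Icc.image_of_continuousOn hcτ)).isBounded.subset_closedBall 0
  have hF : ContDiff ℝ ∞ (fun z : E n × E n => (z.2, -(ε • gradient V z.1))) :=
    contDiff_snd.prodMk (((contDiff_gradient hV).comp contDiff_fst).const_smul ε).neg
  obtain ⟨K, hK⟩ := hF.contDiffOn.exists_lipschitzOnWith (by simp)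
    (convex_closedBall (0 : E n × E n) r) (isCompact_closedBall 0 r)
  have hd : ∀ {ρ : ℝ → E n × E n}, IsFlowLine (hamiltonian fun x => ε * V x) T z ρ →
      ∀ t ∈ Ico 0 T, HasDerivWithinAt ρ ((ρ t).2, -(ε • gradient V (ρ t).1)) (Ici t) t := by
    intro ρ hρ t ht
    have := hρ.2 t (Ico_subset_Icc_self ht)
    rw [hamiltonianField_scaled hV] at this
    exact (this.mono (Icc_subset_Icc_left ht.1)).mono_of_mem_nhdsWithin (Icc_mem_nhdsGE ht.2)
  exact ODE_solution_unique_of_mem_Icc_right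
    (v := fun _ z => (z.2, -(ε • gradient V z.1))) (s := fun _ => Metric.closedBall 0 r)
    (fun _ _ => hK) hcσ (hd hσ)
    (fun t ht => hr (Or.inl (mem_image_of_mem _ (Ico_subset_Icc_self ht)))) hcτ (hd hτ)
    (fun t ht => hr (Or.inr (mem_image_of_mem _ (Ico_subset_Icc_self ht)))) (hσ.1.trans hτ.1.symm)

theorem hasDerivWithinAt_newton {g : C(E n, E n)} {p : ℝ × (E n × E n)} {q : C(I01, E n)}
    (hq : IsNewton g p q) {t : ℝ} (ht : t ∈ Icc (0 : ℝ) 1) :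
    HasDerivWithinAt (ext01 q) (ext01 (momentum g p q) t) (Icc 0 1) t := by
  refine ((hasDerivWithinAt_ext01_primitive (momentum g p q) ht).const_add p.2.1).congr_of_mem
    (fun s hs => ?_) ht
  rw [ext01_of_mem _ hs, ext01_of_mem _ hs]
  exact congrArg (fun q : C(I01, E n) => q ⟨s, hs⟩) (isNewton_iff.1 hq)

theorem hasDerivWithinAt_momentum (g : C(E n, E n)) (p : ℝ × (E n × E n)) (q : C(I01, E n))
    {t : ℝ} (ht : t ∈ Icc (0 : ℝ) 1) :
    HasDerivWithinAt (ext01 (momentum g p q)) (-(p.1 • g (ext01 q t))) (Icc 0 1) t := by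
  refine (((hasDerivWithinAt_ext01_primitive (g.comp q) ht).const_smul p.1).const_sub
    p.2.2).congr_of_mem (fun s hs => ?_) ht
  rw [ext01_of_mem _ hs, Pi.smul_apply, ext01_of_mem _ hs]
  rfl

theorem momentum_zero (g : C(E n, E n)) (p : ℝ × (E n × E n)) (q : C(I01, E n)) :
    ext01 (momentum g p q) 0 = p.2.2 := by
  rw [ext01_of_mem _ (left_mem_Icc.2 zero_le_one)]
  simp [momentum, primitive_zero]

theorem IsNewton.apply_zero {g : C(E n, E n)} {p : ℝ × (E n × E n)} {q : C(I01, E n)}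
    (hq : IsNewton g p q) : ext01 q 0 = p.2.1 := by
  rw [ext01_of_mem _ (left_mem_Icc.2 zero_le_one), isNewton_iff.1 hq]
  simp [primitive_zero]

theorem IsNewton.isFlowLine (hV : ContDiff ℝ ∞ V) {ε T : ℝ} (hT : T ≤ 1) {z : E n × E n}
    {q : C(I01, E n)} (hq : IsNewton (gradientMap V hV) (ε, z) q) :
    IsFlowLine (hamiltonian fun x => ε * V x) T z
      (fun t => (ext01 q t, ext01 (momentum (gradientMap V hV) (ε, z) q) t)) := by
  refine ⟨Prod.ext hq.apply_zero (momentum_zero _ _ _), fun t ht => ?_⟩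
  have ht' : t ∈ Icc (0 : ℝ) 1 := ⟨ht.1, ht.2.trans hT⟩
  rw [hamiltonianField_scaled hV]
  exact ((hasDerivWithinAt_newton hq ht').prodMk
    (hasDerivWithinAt_momentum _ _ q ht')).mono (Icc_subset_Icc_right hT)

/-- `flow` at time `t` chooses some solution on `[0,t]` only; uniqueness on that interval makes the
choice irrelevant. -/
theorem IsNewton.Phi_eq (hV : ContDiff ℝ ∞ V) {ε : ℝ} {z : E n × E n} {q : C(I01, E n)}
    (hq : IsNewton (gradientMap V hV) (ε, z) q) {t : ℝ} (ht : t ∈ Icc (0 : ℝ) 1) :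
    Phi (fun x => ε * V x) t z = ext01 q t := by
  have hl := hq.isFlowLine hV ht.2
  have hex : ∃ σ, IsFlowLine (hamiltonian fun x => ε * V x) t z σ := ⟨_, hl⟩
  rw [Phi, flow, dif_pos hex]
  have := (hex.choose_spec).eqOn hV hl (right_mem_Icc.2 ht.1)
  rw [this]

theorem IsNewton.unique (hV : ContDiff ℝ ∞ V) {p : ℝ × (E n × E n)} {q r : C(I01, E n)}
    (hq : IsNewton (gradientMap V hV) p q) (hr : IsNewton (gradientMap V hV) p r) : q = r := by
  ext1 t
  have h1 := IsNewton.Phi_eq hV hq t.2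
  have h2 := IsNewton.Phi_eq hV hr t.2
  rw [ext01_coe] at h1 h2
  exact h1.symm.trans h2

open Classical in
/-- The solution of Newton's equation `q'' = -ε ∇V(q)` with initial data `z`, for `p = (ε, z)`
(with a dummy value if there is none). -/
noncomputable def newtonSol (V : E n → ℝ) (hV : ContDiff ℝ ∞ V) (p : ℝ × (E n × E n)) :
    C(I01, E n) :=
  if h : ∃ q, IsNewton (gradientMap V hV) p q then h.choose else 0

theorem IsNewton.newtonSol_eq (hV : ContDiff ℝ ∞ V) {p : ℝ × (E n × E n)} {q : C(I01, E n)}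
    (hq : IsNewton (gradientMap V hV) p q) : newtonSol V hV p = q := by
  have hex : ∃ q, IsNewton (gradientMap V hV) p q := ⟨q, hq⟩
  rw [newtonSol, dif_pos hex]
  exact hex.choose_spec.unique hV hq

theorem newtonSol_zero (hV : ContDiff ℝ ∞ V) (z : E n × E n) :
    newtonSol V hV (0, z) = affinePath n z :=
  (isNewton_zero _ z).newtonSol_eq hV

/-- By uniqueness the global choice `newtonSol` coincides near `(0, z₀)` with the implicit function,
and inherits its smoothness. -/
theorem contDiffAt_newtonSol (hV : ContDiff ℝ ∞ V) (z₀ : E n × E n) :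
    ContDiffAt ℝ ∞ (newtonSol V hV) (0, z₀) ∧
      ∀ᶠ p in 𝓝 (0, z₀), IsNewton (gradientMap V hV) p (newtonSol V hV p) := by
  obtain ⟨Q, hQ, hN⟩ := exists_local_newton (gradientMap V hV) (contDiff_gradient hV) z₀
  refine ⟨hQ.congr_of_eventuallyEq ?_, ?_⟩
  · filter_upwards [hN] with p hp using hp.newtonSol_eq hV
  · filter_upwards [hN] with p hp
    rwa [hp.newtonSol_eq hV]

end Flow

/-! ### Costs parametrized by covectors, and their cross-curvature -/

/-- A cost `c` that is generated on an open set `W` of covectors: `c (x, Φ z) = A z` for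
`z = (x, α) ∈ W`, where `z ↦ (x, Φ z)` is a diffeomorphism from `W` onto its image. -/
structure GeneratedCost {n : ℕ} (c : E n → E n → ℝ) (W : Set (E n × E n))
    (Φ : E n × E n → E n) (A : E n × E n → ℝ) : Prop where
  isOpen : IsOpen W
  contDiffAt : ∀ z ∈ W, ContDiffAt ℝ 5 Φ z
  contDiffAt_value : ∀ z ∈ W, ContDiffAt ℝ 5 A z
  isInvertible : ∀ z ∈ W, (fderiv ℝ Φ z ∘L .inr ℝ (E n) (E n)).IsInvertible
  injOn : InjOn (fun z => (z.1, Φ z)) W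
  cost_eq : ∀ z ∈ W, c z.1 (Φ z) = A z

namespace GeneratedCost

variable {n : ℕ} {c : E n → E n → ℝ} {W : Set (E n × E n)} {Φ : E n × E n → E n}
  {A : E n × E n → ℝ}

/-- The differential of `(x, α) ↦ (x, Φ(x, α))` is block triangular with diagonal blocks `id` and
`∂_α Φ`. -/
theorem exists_equiv (h : GeneratedCost c W Φ A) {z : E n × E n} (hz : z ∈ W) :
    ∃ e : (E n × E n) ≃L[ℝ] (E n × E n),
      HasStrictFDerivAt (fun z => (z.1, Φ z)) (e : E n × E n →L[ℝ] E n × E n) z := by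
  obtain ⟨m, hm⟩ := h.isInvertible z hz
  refine ⟨ContinuousLinearEquiv.skewProd (.refl ℝ (E n)) m
    (fderiv ℝ Φ z ∘L .inl ℝ (E n) (E n)), ?_⟩
  have h1 : HasStrictFDerivAt (fun z => (z.1, Φ z))
      ((ContinuousLinearMap.fst ℝ (E n) (E n)).prod (fderiv ℝ Φ z)) z :=
    hasStrictFDerivAt_fst.prodMk ((h.contDiffAt z hz).hasStrictFDerivAt (by simp))
  convert h1 using 1
  refine ContinuousLinearMap.ext fun w => ?_
  have hw : fderiv ℝ Φ z w = fderiv ℝ Φ z (w.1, 0) + fderiv ℝ Φ z (0, w.2) := by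
    rw [← map_add]; simp
  have hm' : fderiv ℝ Φ z (0, w.2) = m w.2 :=
    (congrArg (fun L : E n →L[ℝ] E n => L w.2) hm).symm
  simp [hw, hm', add_comm]

theorem map_nhds (h : GeneratedCost c W Φ A) {z : E n × E n} (hz : z ∈ W) :
    map (fun z => (z.1, Φ z)) (𝓝 z) = 𝓝 (z.1, Φ z) := by
  obtain ⟨e, he⟩ := h.exists_equiv hz
  exact he.map_nhds_eq_of_equiv

theorem isOpen_image (h : GeneratedCost c W Φ A) : IsOpen ((fun z => (z.1, Φ z)) '' W) := by
  rw [isOpen_iff_mem_nhds]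
  rintro _ ⟨z, hz, rfl⟩
  rw [← h.map_nhds hz]
  exact image_mem_map (h.isOpen.mem_nhds hz)

/-- Near the image point, `c` is `A` composed with the local inverse of `z ↦ (z.1, Φ z)`, whose
values lie in `W` there. -/
theorem contDiffAt_cost (h : GeneratedCost c W Φ A) {z : E n × E n} (hz : z ∈ W) :
    ContDiffAt ℝ 5 (fun w : E n × E n => c w.1 w.2) (z.1, Φ z) := by
  obtain ⟨e, he⟩ := h.exists_equiv hz
  have hΘ : ContDiffAt ℝ 5 (fun z => (z.1, Φ z)) z := contDiffAt_fst.prodMk (h.contDiffAt z hz)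
  have hinv := hΘ.to_localInverse he.hasFDerivAt (by simp)
  have h0 := hΘ.localInverse_apply_image he.hasFDerivAt (by simp)
  set I := hΘ.localInverse he.hasFDerivAt (by simp) with hI
  have hA : ContDiffAt ℝ 5 (fun w => A (I w)) (z.1, Φ z) :=
    ContDiffAt.comp (g := A) _ (by rw [h0]; exact h.contDiffAt_value z hz) hinv
  refine hA.congr_of_eventuallyEq ?_
  have h1 : ∀ᶠ w in 𝓝 (z.1, Φ z), I w ∈ W := by
    have := hinv.continuousAt
    rw [ContinuousAt, h0] at this
    exact this (h.isOpen.mem_nhds hz)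
  have h2 : ∀ᶠ w in 𝓝 (z.1, Φ z), ((I w).1, Φ (I w)) = w :=
    (hΘ.hasStrictFDerivAt' he.hasFDerivAt (by simp)).eventually_right_inverse
  filter_upwards [h1, h2] with w hw1 hw2
  rw [← h.cost_eq _ hw1]
  exact congrArg (fun w : E n × E n => c w.1 w.2) hw2.symm

/-- `d_x c`, through the differential of `c` in both variables. -/
theorem hasGradientAt_gradX (h : GeneratedCost c W Φ A) {z : E n × E n} (hz : z ∈ W) :
    HasGradientAt (fun x => c x (Φ z)) (gradX c z.1 (Φ z)) z.1 := by
  have h1 := ((h.contDiffAt_cost hz).differentiableAt (by simp)).comp z.1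
    ((differentiableAt_id (𝕜 := ℝ)).prodMk (differentiableAt_const (Φ z)))
  exact h1.hasGradientAt

theorem contDiffAt_gradX (h : GeneratedCost c W Φ A) {z : E n × E n} (hz : z ∈ W) :
    ContDiffAt ℝ 4 (fun w : E n × E n => gradX c w.1 w.2) (z.1, Φ z) := by
  have h1 : ContDiffAt ℝ 4 (fun w => (InnerProductSpace.toDual ℝ (E n)).symm
      (fderiv ℝ (fun w : E n × E n => c w.1 w.2) w ∘L .inl ℝ (E n) (E n))) (z.1, Φ z) := by
    have h2 := (h.contDiffAt_cost hz).fderiv_right (m := 4) (by norm_num)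
    exact (InnerProductSpace.toDual ℝ (E n)).symm.contDiff.contDiffAt.comp _
      (h2.clm_comp contDiffAt_const)
  refine h1.congr_of_eventuallyEq ?_
  filter_upwards [h.isOpen_image.mem_nhds (mem_image_of_mem _ hz)]
  rintro _ ⟨z', hz', rfl⟩
  have h3 := HasFDerivAt.comp (g := fun w : E n × E n => c w.1 w.2)
    (f := fun x => (x, Φ z')) z'.1
    ((h.contDiffAt_cost hz').differentiableAt (by simp)).hasFDerivAt
    (hasFDerivAt_prodMk_left z'.1 (Φ z'))
  exact congrArg _ h3.fderiv

theorem mem_of_mem_cExpDomain (hgrad : ∀ z ∈ W, gradX c z.1 (Φ z) = -z.2)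
    {z : E n × E n}
    (hz : z ∈ cExpDomain c ((fun z => (z.1, Φ z)) '' W)) : z ∈ W := by
  obtain ⟨y, ⟨z', hz', hy⟩, h2⟩ := hz
  obtain ⟨h1, rfl⟩ := Prod.ext_iff.1 hy
  simp only at h1
  rw [← h1, hgrad z' hz', neg_neg] at h2
  rwa [Prod.ext h1.symm h2]

section Gradient

variable (h : GeneratedCost c W Φ A) (hgrad : ∀ z ∈ W, gradX c z.1 (Φ z) = -z.2)

include h hgrad

/-- The identity `d_x c(x, Φ(x, α)) = -α`, differentiated in the direction `(u, v)`. -/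
theorem fderiv_gradX_apply {z : E n × E n} (hz : z ∈ W) (u v : E n) :
    fderiv ℝ (fun w : E n × E n => gradX c w.1 w.2) (z.1, Φ z) (u, fderiv ℝ Φ z (u, v)) = -v := by
  have h1 := ((h.contDiffAt_gradX hz).differentiableAt (by simp)).hasFDerivAt
  have h2 : HasFDerivAt (fun z => (z.1, Φ z))
      ((ContinuousLinearMap.fst ℝ (E n) (E n)).prod (fderiv ℝ Φ z)) z :=
    hasFDerivAt_fst.prodMk ((h.contDiffAt z hz).differentiableAt (by simp)).hasFDerivAt
  have h3 := HasFDerivAt.comp z h1 h2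
  have h4 : HasFDerivAt (fun z : E n × E n => -z.2) (-ContinuousLinearMap.snd ℝ (E n) (E n)) z :=
    hasFDerivAt_snd.neg
  have h5 := h4.congr_of_eventuallyEq (f₁ := (fun w : E n × E n => gradX c w.1 w.2) ∘
    fun z => (z.1, Φ z)) (by
      filter_upwards [h.isOpen.mem_nhds hz] with z' hz' using hgrad z' hz')
  have h6 := congrArg (fun L : E n × E n →L[ℝ] E n => L (u, v)) (h3.unique h5)
  simpa using h6

/-- The Hessian of `c` in `x`: the covector is varied together with `x`, with `v = -(∂_α Φ)⁻¹ ∂_x Φ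
u`, so that the endpoint is fixed to first order. -/
theorem fderiv_gradX_inl {z : E n × E n} (hz : z ∈ W) (u : E n) :
    fderiv ℝ (fun w : E n × E n => gradX c w.1 w.2) (z.1, Φ z) (u, 0) =
      (fderiv ℝ Φ z ∘L .inr ℝ (E n) (E n)).inverse (fderiv ℝ Φ z (u, 0)) := by
  obtain ⟨m, hm⟩ := h.isInvertible z hz
  have hm' : ∀ v, fderiv ℝ Φ z (0, v) = m v := fun v =>
    (congrArg (fun L : E n →L[ℝ] E n => L v) hm).symm
  have h1 := h.fderiv_gradX_apply hgrad hz u (-m.symm (fderiv ℝ Φ z (u, 0)))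
  have h2 : fderiv ℝ Φ z (u, -m.symm (fderiv ℝ Φ z (u, 0))) = 0 := by
    have : (u, -m.symm (fderiv ℝ Φ z (u, 0))) =
      ((u, 0) : E n × E n) + (0, -m.symm (fderiv ℝ Φ z (u, 0))) := by simp
    rw [this, map_add, hm']
    simp
  rw [h2] at h1
  rw [h1, ← hm]
  simp

theorem nondegenerate : Nondegenerate c ((fun z => (z.1, Φ z)) '' W) where
  isOpen := h.isOpen_image
  a0 := by
    rintro _ ⟨z, hz, rfl⟩
    exact ((h.contDiffAt_cost hz).of_le (by norm_num)).contDiffWithinAt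
  a1 := by
    rintro x _ ⟨z, hz, hzx⟩ _ ⟨z', hz', hzx'⟩ heq
    obtain ⟨rfl, rfl⟩ := Prod.ext_iff.1 hzx
    obtain ⟨h1, rfl⟩ := Prod.ext_iff.1 hzx'
    simp only at h1 heq ⊢
    rw [hgrad z hz, ← h1, hgrad z' hz', neg_inj] at heq
    rw [Prod.ext h1.symm heq]
  a2 := by
    rintro x _ ⟨z, hz, hzx⟩
    obtain ⟨rfl, rfl⟩ := Prod.ext_iff.1 hzx
    obtain ⟨m, hm⟩ := h.isInvertible z hz
    have hm' : ∀ v, fderiv ℝ Φ z (0, v) = m v := fun v =>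
      (congrArg (fun L : E n →L[ℝ] E n => L v) hm).symm
    have h1 := ((h.contDiffAt_gradX hz).differentiableAt (by simp)).hasFDerivAt.comp (Φ z)
      (hasFDerivAt_prodMk_right z.1 (Φ z))
    have h2 : fderiv ℝ (gradX c z.1) (Φ z) = _ := h1.fderiv
    simp only
    rw [h2]
    refine (injective_iff_map_eq_zero _).2 fun k hk => ?_
    have h3 := h.fderiv_gradX_apply hgrad hz 0 (m.symm k)
    rw [hm', m.apply_symm_apply] at h3
    have h4 : m.symm k = 0 := by
      rw [← neg_eq_zero, ← h3]
      exact hk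
    simpa using h4

theorem cExp_eq {z : E n × E n} (hz : z ∈ W) :
    cExp c ((fun z => (z.1, Φ z)) '' W) z.1 z.2 = Φ z := by
  have h1 := (h.nondegenerate hgrad).a1 z.1
  have h2 : Φ z ∈ {y | (z.1, y) ∈ (fun z => (z.1, Φ z)) '' W} := mem_image_of_mem _ hz
  have h3 := h1.leftInvOn_invFunOn h2
  rw [hgrad z hz] at h3
  exact h3

/-- The Hessian of `c` on `γ'(0)` plus the pairing of `d_x c = -α` with the acceleration of `γ`. -/
theorem iteratedDeriv_cost_curve {γ : ℝ → E n} (hγ : ContDiff ℝ ∞ γ) {α : E n}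
    (hz : (γ 0, α) ∈ W) :
    iteratedDeriv 2 (fun t => c (γ t) (Φ (γ 0, α))) 0 =
      inner ℝ ((fderiv ℝ Φ (γ 0, α) ∘L .inr ℝ (E n) (E n)).inverse
        (fderiv ℝ Φ (γ 0, α) (deriv γ 0, 0))) (deriv γ 0) - inner ℝ α (deriv (deriv γ) 0) := by
  set y := Φ (γ 0, α) with hy
  have hγd : ∀ t, HasDerivAt γ (deriv γ t) t := fun t =>
    (hγ.differentiable (by simp) t).hasDerivAt
  have hγ' : ContDiff ℝ ∞ (deriv γ) := (contDiff_infty_iff_deriv.1 hγ).2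
  have hγd2 : HasDerivAt (deriv γ) (deriv (deriv γ) 0) 0 :=
    (hγ'.differentiable (by simp) 0).hasDerivAt
  have h1 : deriv (fun t => c (γ t) y) =ᶠ[𝓝 0] fun t => inner ℝ (gradX c (γ t) y) (deriv γ t) := by
    have hcont : ContinuousAt (fun t => (γ t, y)) 0 :=
      (hγ.continuous.prodMk continuous_const).continuousAt
    filter_upwards [hcont (h.isOpen_image.mem_nhds (mem_image_of_mem _ hz))]
    rintro t ⟨z', hz', ht⟩
    obtain ⟨h2, h3⟩ := Prod.ext_iff.1 ht
    simp only at h2 h3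
    have h4 := h.hasGradientAt_gradX hz'
    rw [h2, h3] at h4
    have := h4.hasFDerivAt.comp_hasDerivAt t (hγd t)
    rw [HasDerivAt.deriv (f := fun t => c (γ t) y) this]
    simp
  rw [iteratedDeriv_succ, iteratedDeriv_one, h1.deriv_eq]
  have h5 : HasDerivAt (fun t => gradX c (γ t) y)
      (fderiv ℝ (fun w : E n × E n => gradX c w.1 w.2) (γ 0, y) (deriv γ 0, 0)) 0 :=
    HasFDerivAt.comp_hasDerivAt (l := fun w : E n × E n => gradX c w.1 w.2) (0 : ℝ)
      ((h.contDiffAt_gradX hz).differentiableAt (by simp)).hasFDerivAt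
      ((hγd 0).prodMk (hasDerivAt_const 0 y))
  have h6 := h.fderiv_gradX_inl hgrad hz (deriv γ 0)
  rw [← hy] at h6
  rw [(h5.inner ℝ hγd2).deriv, h6]
  have h7 := hgrad _ hz
  rw [← hy] at h7
  simp only at h7
  rw [h7, inner_neg_left]
  ring

/-- The acceleration of `γ` is paired with `α + s α₁`, which is affine in `s`, so `∂_s²` removes it.
Hence the cross-curvature depends on `γ` only through `γ 0` and `γ'(0)`. -/
theorem crossCurvature_eq {γ : ℝ → E n} (hγ : ContDiff ℝ ∞ γ) {α : E n} (α₁ : E n)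
    (hz : (γ 0, α) ∈ W) :
    crossCurvature c ((fun z => (z.1, Φ z)) '' W) γ α α₁ = -(3 / 2) * iteratedDeriv 2 (fun s : ℝ =>
      inner ℝ ((fderiv ℝ Φ (γ 0, α + s • α₁) ∘L .inr ℝ (E n) (E n)).inverse
        (fderiv ℝ Φ (γ 0, α + s • α₁) (deriv γ 0, 0))) (deriv γ 0)) 0 := by
  rw [crossCurvature]
  congr 1
  have hl : ContDiff ℝ 2 (fun s : ℝ => ((γ 0, α + s • α₁) : E n × E n)) := by fun_prop
  have h0 : ((γ 0, α + (0 : ℝ) • α₁) : E n × E n) = (γ 0, α) := by simp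
  have hmem : ∀ᶠ s : ℝ in 𝓝 0, ((γ 0, α + s • α₁) : E n × E n) ∈ W :=
    hl.continuous.continuousAt.eventually_mem (by rw [h0]; exact h.isOpen.mem_nhds hz)
  have heq : (fun s : ℝ => iteratedDeriv 2 (fun t : ℝ =>
      c (γ t) (cExp c ((fun z => (z.1, Φ z)) '' W) (γ 0) (α + s • α₁))) 0) =ᶠ[𝓝 0]
      fun s : ℝ => inner ℝ ((fderiv ℝ Φ (γ 0, α + s • α₁) ∘L .inr ℝ (E n) (E n)).inverse
        (fderiv ℝ Φ (γ 0, α + s • α₁) (deriv γ 0, 0))) (deriv γ 0)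
        - inner ℝ (α + s • α₁) (deriv (deriv γ) 0) := by
    filter_upwards [hmem] with s hs
    have h1 := h.cExp_eq hgrad hs
    simp only at h1
    rw [h1]
    exact h.iteratedDeriv_cost_curve hgrad hγ hs
  rw [heq.iteratedDeriv_eq]
  have hΦ : ContDiffAt ℝ 2 (fun s : ℝ => fderiv ℝ Φ (γ 0, α + s • α₁)) 0 := by
    refine ContDiffAt.comp (g := fderiv ℝ Φ) (0 : ℝ) ?_ hl.contDiffAt
    rw [h0]
    exact (h.contDiffAt _ hz).fderiv_right (m := 2) (by norm_num)
  have hinv : ContDiffAt ℝ 2 (fun s : ℝ =>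
      (fderiv ℝ Φ (γ 0, α + s • α₁) ∘L .inr ℝ (E n) (E n)).inverse) 0 := by
    refine ContDiffAt.comp (g := ContinuousLinearMap.inverse) (0 : ℝ) ?_
      (hΦ.clm_comp contDiffAt_const)
    refine ContinuousLinearMap.IsInvertible.contDiffAt_map_inverse ?_
    rw [h0]
    exact h.isInvertible _ hz
  have hf1 : ContDiffAt ℝ 2 (fun s : ℝ =>
      inner ℝ ((fderiv ℝ Φ (γ 0, α + s • α₁) ∘L .inr ℝ (E n) (E n)).inverse
        (fderiv ℝ Φ (γ 0, α + s • α₁) (deriv γ 0, 0))) (deriv γ 0)) 0 :=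
    (hinv.clm_apply (hΦ.clm_apply contDiffAt_const)).inner ℝ contDiffAt_const
  have hf2 : ContDiffAt ℝ 2 (fun s : ℝ => inner ℝ (α + s • α₁) (deriv (deriv γ) 0)) 0 :=
    ContDiffAt.inner ℝ (by fun_prop) contDiffAt_const
  have hz2 : iteratedDeriv 2 (fun s : ℝ => inner ℝ (α + s • α₁) (deriv (deriv γ) 0)) 0 = 0 := by
    have h1 : ∀ s, HasDerivAt (fun s : ℝ => inner ℝ (α + s • α₁) (deriv (deriv γ) 0))
        (inner ℝ α₁ (deriv (deriv γ) 0)) s := by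
      intro s
      have := (((hasDerivAt_id s).smul_const α₁).const_add α).inner ℝ
        (hasDerivAt_const s (deriv (deriv γ) 0))
      simpa using this
    rw [iteratedDeriv_succ, iteratedDeriv_one, funext fun s => (h1 s).deriv]
    simp
  have := iteratedDeriv_fun_sub (n := 2) hf1 hf2
  rw [this, hz2, sub_zero]

end Gradient

end GeneratedCost

/-! ### The action and its first variation -/

section Action

variable {n : ℕ} {V : E n → ℝ}

/-- The kinetic energy `|v|² / 2`. -/
noncomputable def kineticMap (n : ℕ) : C(E n, ℝ) := ⟨fun v => ‖v‖ ^ 2 / 2, by fun_prop⟩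

theorem contDiff_kineticMap (n : ℕ) : ContDiff ℝ ∞ (kineticMap n) :=
  (contDiff_norm_sq ℝ).div_const 2

theorem hasFDerivAt_kineticMap (v : E n) : HasFDerivAt (kineticMap n) (innerSL ℝ v) v := by
  have := (hasStrictFDerivAt_norm_sq v).hasFDerivAt.mul_const (1 / 2 : ℝ)
  refine (this.congr_fderiv ?_).congr_of_eventuallyEq (Eventually.of_forall fun p => ?_)
  · ext w; simp
  · simp [kineticMap, div_eq_mul_inv]

/-- The potential as a continuous map. -/
def potentialMap (V : E n → ℝ) (hV : ContDiff ℝ ∞ V) : C(E n, ℝ) := ⟨V, hV.continuous⟩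

/-- Stated for any curve with continuous velocity `m`, so as to serve both trajectories and their
variations. -/
theorem action_eq (hV : ContDiff ℝ ∞ V) {ε : ℝ} {r m : C(I01, E n)} {a : E n}
    (hr : r = ContinuousMap.const I01 a + primitive (E n) m) {γ : ℝ → E n}
    (hγ : EqOn γ (ext01 r) (Icc 0 1)) :
    action (fun x => ε * V x) γ = integral01 ℝ ((kineticMap n).comp m) -
      ε * integral01 ℝ ((potentialMap V hV).comp r) := by
  rw [integral01_apply, integral01_apply, ← intervalIntegral.integral_const_mul,
    ← intervalIntegral.integral_sub ((continuous_ext01 _).intervalIntegrable _ _)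
      (((continuous_ext01 _).const_mul ε).intervalIntegrable _ _), action]
  refine intervalIntegral.integral_congr fun t ht => ?_
  rw [uIcc_of_le zero_le_one] at ht
  have h1 : HasDerivWithinAt γ (ext01 m t) (Icc 0 1) t := by
    refine ((hasDerivWithinAt_ext01_primitive m ht).const_add a).congr_of_mem (fun s hs => ?_) ht
    rw [hγ hs, ext01_of_mem _ hs, ext01_of_mem _ hs]
    exact congrArg (fun q : C(I01, E n) => q ⟨s, hs⟩) hr
  rw [h1.derivWithin (uniqueDiffOn_Icc zero_lt_one t ht), hγ ht, lagrangian, ext01_of_mem _ ht,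
    ext01_of_mem _ ht, ext01_of_mem _ ht, ext01_of_mem _ ht]
  rfl

theorem add_zero_smul (a b : C(I01, E n)) : a + (0 : ℝ) • b = a := by
  ext1 t
  simp

theorem cost_eq_of_isLeastAction {V : E n → ℝ} {x y : E n} {γ : ℝ → E n}
    (h : IsLeastAction V x y γ) : cost V x y = action V γ := by
  refine IsLeast.csInf_eq ⟨mem_image_of_mem _ h.1, ?_⟩
  rintro _ ⟨η, hη, rfl⟩
  exact h.2 η hη

/-- First variation of the action in the direction of the field `t ↦ (1 - t) k`. -/
theorem hasDerivAt_action_variation (hV : ContDiff ℝ ∞ V) (ε : ℝ) (z : E n × E n)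
    (q : C(I01, E n)) (k : E n) :
    HasDerivAt (fun τ : ℝ => integral01 ℝ ((kineticMap n).comp
        (momentum (gradientMap V hV) (ε, z) q + τ • ContinuousMap.const I01 (-k))) -
      ε * integral01 ℝ ((potentialMap V hV).comp (q + τ • affinePath n (k, -k))))
      (-inner ℝ z.2 k) 0 := by
  set P := momentum (gradientMap V hV) (ε, z) q with hP
  let kin' : C(E n, E n →L[ℝ] ℝ) := ⟨fun v => innerSL ℝ v, by fun_prop⟩
  let V' : C(E n, E n →L[ℝ] ℝ) := ⟨fderiv ℝ V, hV.continuous_fderiv (by simp)⟩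
  have hline : ∀ a b : C(I01, E n), HasDerivAt (fun τ : ℝ => a + τ • b) b 0 := fun a b => by
    simpa using ((hasDerivAt_id (0 : ℝ)).smul_const b).const_add a
  have h1 : HasDerivAt (fun τ : ℝ => (kineticMap n).comp (P + τ • ContinuousMap.const I01 (-k)))
      (pointwiseApply I01 (E n) ℝ (kin'.comp P) (ContinuousMap.const I01 (-k))) 0 := by
    exact (hasFDerivAt_superposition (K := I01) (kineticMap n) kin'
      (fun v => hasFDerivAt_kineticMap v) P).comp_hasDerivAt_of_eq (0 : ℝ)
      (hline P (ContinuousMap.const I01 (-k))) (add_zero_smul _ _).symm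
  have h2 : HasDerivAt (fun τ : ℝ => (potentialMap V hV).comp (q + τ • affinePath n (k, -k)))
      (pointwiseApply I01 (E n) ℝ (V'.comp q) (affinePath n (k, -k))) 0 := by
    exact (hasFDerivAt_superposition (K := I01) (potentialMap V hV) V'
      (fun x => (hV.differentiable (by simp) x).hasFDerivAt) q).comp_hasDerivAt_of_eq (0 : ℝ)
      (hline q (affinePath n (k, -k))) (add_zero_smul _ _).symm
  have h3 := ((integral01 ℝ).hasFDerivAt.comp_hasDerivAt (0 : ℝ) h1).sub
    (((integral01 ℝ).hasFDerivAt.comp_hasDerivAt (0 : ℝ) h2).const_mul ε)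
  refine h3.congr_deriv ?_
  rw [integral01_apply, integral01_apply, ← intervalIntegral.integral_const_mul,
    ← intervalIntegral.integral_sub ((continuous_ext01 _).intervalIntegrable _ _)
      (((continuous_ext01 _).const_mul ε).intervalIntegrable _ _)]
  -- Since `P' = -ε ∇V(q)`, this `F` is a primitive of the varied integrand. Only its value `⟨α, k⟩`
  -- at `t = 0` contributes.
  set F : ℝ → ℝ := fun t => (1 - t) * inner ℝ (ext01 P t) k with hF
  have hFc : Continuous F :=
    (continuous_const.sub continuous_id).mul ((continuous_ext01 P).inner continuous_const)
  have hint := intervalIntegral.integral_eq_sub_of_hasDerivAt_of_le (zero_le_one (α := ℝ))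
    (f := F) (f' := fun t =>
      ext01 (pointwiseApply I01 (E n) ℝ (kin'.comp P) (ContinuousMap.const I01 (-k))) t -
      ε * ext01 (pointwiseApply I01 (E n) ℝ (V'.comp q) (affinePath n (k, -k))) t)
    hFc.continuousOn ?_
    (((continuous_ext01 _).sub ((continuous_ext01 _).const_mul ε)).intervalIntegrable _ _)
  · rw [hint]
    have h0 : ext01 P 0 = z.2 := momentum_zero _ _ _
    simp only [hF]
    rw [h0]
    simp
  · intro t ht
    have ht' := Ioo_subset_Icc_self ht
    have hd : HasDerivAt (ext01 P) (-(ε • gradientMap V hV (ext01 q t))) t :=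
      (hasDerivWithinAt_momentum _ _ q ht').hasDerivAt (Icc_mem_nhds ht.1 ht.2)
    have h4 : HasDerivAt (fun t : ℝ => 1 - t) (-1) t := by
      simpa using (hasDerivAt_id t).const_sub 1
    have h5 := h4.mul (hd.inner ℝ (hasDerivAt_const t k))
    refine h5.congr_deriv ?_
    have h6 : fderiv ℝ V (q ⟨t, ht'⟩) k = inner ℝ (gradient V (q ⟨t, ht'⟩)) k :=
      (inner_gradient_left (f := V)).symm
    rw [ext01_of_mem _ ht', ext01_of_mem _ ht', ext01_of_mem _ ht', ext01_of_mem _ ht']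
    change -1 * inner ℝ (P ⟨t, ht'⟩) k + (1 - t) * (inner ℝ (P ⟨t, ht'⟩) 0 +
      inner ℝ (-(ε • gradient V (q ⟨t, ht'⟩))) k) = inner ℝ (P ⟨t, ht'⟩) (-k) -
        ε * fderiv ℝ V (q ⟨t, ht'⟩) (affinePath n (k, -k) ⟨t, ht'⟩)
    rw [affinePath_apply, map_add, map_smul, map_neg, h6, inner_neg_left, real_inner_smul_left,
      inner_neg_right, inner_zero_right, smul_eq_mul]
    ring

end Action

theorem six_le_infty : (6 : ℕ∞ω) ≤ ∞ :=
  WithTop.coe_le_coe.2 (le_top : (6 : ℕ∞) ≤ ⊤)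

/-! ### The mechanical cost as a generated cost -/

section Generated

variable {n : ℕ} (V : E n → ℝ) (hV : ContDiff ℝ ∞ V)

/-- `∫₀¹ ∫₀ᵗ ∇V(q)` along the solution `q` of Newton's equation, so that
`q(1) = x + α - ε ∫₀¹ ∫₀ᵗ ∇V(q)`. -/
noncomputable def remainder (p : ℝ × (E n × E n)) : E n :=
  integral01 (E n) (primitive (E n) ((gradientMap V hV).comp (newtonSol V hV p)))

/-- The action of the solution of Newton's equation with `p = (ε, z)`. -/
noncomputable def actionValue (p : ℝ × (E n × E n)) : ℝ :=
  integral01 ℝ ((kineticMap n).comp (momentum (gradientMap V hV) p (newtonSol V hV p))) -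
    p.1 * integral01 ℝ ((potentialMap V hV).comp (newtonSol V hV p))

/-- The differential of `remainder` in the position. -/
noncomputable def remainderX (p : ℝ × (E n × E n)) : E n →L[ℝ] E n :=
  fderiv ℝ (remainder V hV) p ∘L .inr ℝ ℝ (E n × E n) ∘L .inl ℝ (E n) (E n)

/-- The differential of `remainder` in the velocity. -/
noncomputable def remainderV (p : ℝ × (E n × E n)) : E n →L[ℝ] E n :=
  fderiv ℝ (remainder V hV) p ∘L .inr ℝ ℝ (E n × E n) ∘L .inr ℝ (E n) (E n)

/-- The endpoint of the solution of Newton's equation. -/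
noncomputable def endpointMap (ε : ℝ) (z : E n × E n) : E n :=
  z.1 + z.2 - ε • remainder V hV (ε, z)

/-- Newton's equation is solvable with data `p`, its solution depends smoothly on the data near
`p`, and `p` is not conjugate. -/
structure SolvableAt (p : ℝ × (E n × E n)) : Prop where
  isNewton : IsNewton (gradientMap V hV) p (newtonSol V hV p)
  contDiffAt : ContDiffAt ℝ 6 (newtonSol V hV) p
  isInvertible : (ContinuousLinearMap.id ℝ (E n) - p.1 • remainderV V hV p).IsInvertible

variable {V hV}

theorem SolvableAt.contDiffAt_remainder {p : ℝ × (E n × E n)} (h : ContDiffAt ℝ 6 (newtonSol V hV) p) :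
    ContDiffAt ℝ 6 (remainder V hV) p :=
  (integral01 (E n)).contDiff.contDiffAt.comp p ((primitive (E n)).contDiff.contDiffAt.comp p
    (((contDiff_superposition (K := I01) (gradientMap V hV)
      (contDiff_gradient hV)).of_le six_le_infty).contDiffAt.comp p h))

theorem SolvableAt.contDiffAt_actionValue {p : ℝ × (E n × E n)}
    (h : ContDiffAt ℝ 6 (newtonSol V hV) p) : ContDiffAt ℝ 6 (actionValue V hV) p := by
  have hle : (6 : ℕ∞ω) ≤ ∞ := six_le_infty
  have hm : ContDiffAt ℝ 6 (fun p => momentum (gradientMap V hV) p (newtonSol V hV p)) p := by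
    refine ContDiffAt.sub ((ContinuousLinearMap.const ℝ I01).contDiff.contDiffAt.comp p
      contDiffAt_snd.snd) (contDiffAt_fst.smul ?_)
    exact (primitive (E n)).contDiff.contDiffAt.comp p
      (((contDiff_superposition (K := I01) (gradientMap V hV)
        (contDiff_gradient hV)).of_le hle).contDiffAt.comp p h)
  refine ContDiffAt.sub ((integral01 ℝ).contDiff.contDiffAt.comp p
    (((contDiff_superposition (K := I01) (kineticMap n)
      (contDiff_kineticMap n)).of_le hle).contDiffAt.comp p hm)) (contDiffAt_fst.mul ?_)
  exact (integral01 ℝ).contDiff.contDiffAt.comp p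
    (((contDiff_superposition (K := I01) (potentialMap V hV) hV).of_le hle).contDiffAt.comp p h)

theorem SolvableAt.hasFDerivAt_endpointMap {ε : ℝ} {z : E n × E n} (h : SolvableAt V hV (ε, z)) :
    HasFDerivAt (endpointMap V hV ε) (ContinuousLinearMap.fst ℝ (E n) (E n) +
      ContinuousLinearMap.snd ℝ (E n) (E n) - ε • (fderiv ℝ (remainder V hV) (ε, z) ∘L
        .inr ℝ ℝ (E n × E n))) z := by
  have h1 := HasFDerivAt.comp (g := remainder V hV) (f := fun z => (ε, z)) z
    ((SolvableAt.contDiffAt_remainder h.contDiffAt).differentiableAt (by simp)).hasFDerivAt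
    (hasFDerivAt_prodMk_right ε z)
  exact (hasFDerivAt_fst.add hasFDerivAt_snd).sub (h1.const_smul ε)

theorem SolvableAt.fderiv_endpointMap_inr {ε : ℝ} {z : E n × E n} (h : SolvableAt V hV (ε, z)) :
    fderiv ℝ (endpointMap V hV ε) z ∘L .inr ℝ (E n) (E n) =
      ContinuousLinearMap.id ℝ (E n) - ε • remainderV V hV (ε, z) := by
  rw [h.hasFDerivAt_endpointMap.fderiv]
  ext1 v
  simp [remainderV]

theorem SolvableAt.fderiv_endpointMap_inl {ε : ℝ} {z : E n × E n} (h : SolvableAt V hV (ε, z))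
    (u : E n) : fderiv ℝ (endpointMap V hV ε) z (u, 0) = u - ε • remainderX V hV (ε, z) u := by
  rw [h.hasFDerivAt_endpointMap.fderiv]
  simp [remainderX]

theorem IsNewton.endpointMap_eq {ε : ℝ} {z : E n × E n}
    (h : IsNewton (gradientMap V hV) (ε, z) (newtonSol V hV (ε, z))) :
    endpointMap V hV ε z = Phi (fun x => ε * V x) 1 z := by
  have h1 : (1 : ℝ) ∈ Icc (0 : ℝ) 1 := by simp
  rw [IsNewton.Phi_eq hV h h1, ext01_of_mem _ h1]
  have h2 := congrArg (fun q : C(I01, E n) => q ⟨1, h1⟩) h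
  simp only at h2
  rw [h2, ContinuousMap.sub_apply, affinePath_apply, endpointMap, remainder, ← primitive_one]
  simp

theorem IsNewton.cost_endpointMap {ε : ℝ} {z : E n × E n}
    (h : IsNewton (gradientMap V hV) (ε, z) (newtonSol V hV (ε, z)))
    (hr : IsRegular (fun x => ε * V x) z) :
    cost (fun x => ε * V x) z.1 (endpointMap V hV ε z) = actionValue V hV (ε, z) := by
  rw [h.endpointMap_eq, cost_eq_of_isLeastAction hr.2.1,
    action_eq hV (isNewton_iff.1 h) (fun t ht => IsNewton.Phi_eq hV h ht)]
  rfl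

/-- Equal endpoints force equal least-action paths by uniqueness, hence equal initial velocities. -/
theorem injOn_endpointMap {ε : ℝ} {W : Set (E n × E n)}
    (h : ∀ z ∈ W, IsNewton (gradientMap V hV) (ε, z) (newtonSol V hV (ε, z)))
    (hr : ∀ z ∈ W, IsRegular (fun x => ε * V x) z) :
    InjOn (fun z => (z.1, endpointMap V hV ε z)) W := by
  intro z hz z' hz' heq
  obtain ⟨h1, h2⟩ := Prod.ext_iff.1 heq
  simp only at h1 h2
  rw [(h z hz).endpointMap_eq, (h z' hz').endpointMap_eq] at h2
  have h3 := (hr z' hz').2.1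
  rw [← h1, ← h2] at h3
  have h4 := (hr z hz).2.2 _ h3
  have h5 : EqOn (ext01 (newtonSol V hV (ε, z'))) (ext01 (newtonSol V hV (ε, z))) (Icc 0 1) :=
    fun t ht => by
      rw [← IsNewton.Phi_eq hV (h z hz) ht, ← IsNewton.Phi_eq hV (h z' hz') ht]
      exact h4 ht
  have h0 : (0 : ℝ) ∈ Icc (0 : ℝ) 1 := by simp
  have h6 := hasDerivWithinAt_newton (h z hz) h0
  have h7 := (hasDerivWithinAt_newton (h z' hz') h0).congr_of_mem h5.symm h0
  have hu : UniqueDiffWithinAt ℝ (Icc (0 : ℝ) 1) 0 := uniqueDiffOn_Icc zero_lt_one 0 h0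
  have h8 := (h6.derivWithin hu).symm.trans (h7.derivWithin hu)
  rw [momentum_zero, momentum_zero] at h8
  exact Prod.ext h1 h8

theorem generatedCost {ε : ℝ} {W : Set (E n × E n)} (hW : IsOpen W)
    (h : ∀ z ∈ W, SolvableAt V hV (ε, z)) (hr : ∀ z ∈ W, IsRegular (fun x => ε * V x) z) :
    GeneratedCost (cost fun x => ε * V x) W (endpointMap V hV ε)
      (fun z => actionValue V hV (ε, z)) where
  isOpen := hW
  contDiffAt z hz := by
    refine (contDiffAt_fst.add contDiffAt_snd).sub (ContDiffAt.const_smul ε ?_)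
    exact ContDiffAt.comp (g := remainder V hV) z
      ((SolvableAt.contDiffAt_remainder (h z hz).contDiffAt).of_le (by norm_num))
      (contDiffAt_const.prodMk contDiffAt_id)
  contDiffAt_value z hz := ContDiffAt.comp (g := actionValue V hV) z
      ((SolvableAt.contDiffAt_actionValue (h z hz).contDiffAt).of_le (by norm_num))
      (contDiffAt_const.prodMk contDiffAt_id)
  isInvertible z hz := by
    rw [(h z hz).fderiv_endpointMap_inr]
    exact (h z hz).isInvertible
  injOn := injOn_endpointMap (fun z hz => (h z hz).isNewton) hr
  cost_eq z hz := (h z hz).isNewton.cost_endpointMap (hr z hz)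

/-- The trajectory displaced by `τ (1 - t) k` joins `x + τ k` to `y`, so its action bounds `c(x + τ
k, y)` from above, with equality at `τ = 0`. Both sides are differentiable at `τ = 0`, so their
derivatives agree there, and the first variation of the action is `-⟨α, k⟩`. -/
theorem gradX_endpointMap {ε : ℝ} {W : Set (E n × E n)} (hW : IsOpen W)
    (h : ∀ z ∈ W, SolvableAt V hV (ε, z)) (hr : ∀ z ∈ W, IsRegular (fun x => ε * V x) z)
    {z : E n × E n} (hz : z ∈ W) :
    gradX (cost fun x => ε * V x) z.1 (endpointMap V hV ε z) = -z.2 := by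
  have hgen := generatedCost hW h hr
  set c := cost fun x => ε * V x with hc
  set y := endpointMap V hV ε z with hy
  have hN := (h z hz).isNewton
  set q := newtonSol V hV (ε, z) with hq
  refine ext_inner_right ℝ fun k => ?_
  have h1 : HasDerivAt (fun τ : ℝ => c (z.1 + τ • k) y) (inner ℝ (gradX c z.1 y) k) 0 := by
    have hl : HasDerivAt (fun τ : ℝ => z.1 + τ • k) k 0 := by
      simpa using ((hasDerivAt_id (0 : ℝ)).smul_const k).const_add z.1
    have h2 := (hgen.hasGradientAt_gradX hz).hasFDerivAt.comp_hasDerivAt_of_eq (0 : ℝ) hl (by simp)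
    exact h2.congr_deriv (by simp [hy])
  have h2 := hasDerivAt_action_variation hV ε z q k
  set a : ℝ → ℝ := fun τ => integral01 ℝ ((kineticMap n).comp
        (momentum (gradientMap V hV) (ε, z) q + τ • ContinuousMap.const I01 (-k))) -
      ε * integral01 ℝ ((potentialMap V hV).comp (q + τ • affinePath n (k, -k))) with ha
  have hPhi : ∀ t ∈ Icc (0 : ℝ) 1, Phi (fun x => ε * V x) t z = ext01 q t :=
    fun t ht => IsNewton.Phi_eq hV hN ht
  -- For small `τ` the pair `(x + τ k, y)` again comes from a regular covector. Its cost is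
  -- therefore attained, and `sInf` is a true lower bound of the actions.
  have hle : ∀ᶠ τ : ℝ in 𝓝 0, c (z.1 + τ • k) y ≤ a τ := by
    have hcont : Continuous fun τ : ℝ => ((z.1 + τ • k, y) : E n × E n) := by fun_prop
    have hmem : ((z.1 + (0 : ℝ) • k, y) : E n × E n) ∈
        (fun z => (z.1, endpointMap V hV ε z)) '' W := ⟨z, hz, by simp [hy]⟩
    filter_upwards [hcont.continuousAt (hgen.isOpen_image.mem_nhds hmem)]
    rintro τ ⟨z', hz', hτ⟩
    obtain ⟨h3, h4⟩ := Prod.ext_iff.1 hτ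
    simp only at h3 h4
    have hl := (hr z' hz').2.1
    rw [← (h z' hz').isNewton.endpointMap_eq, h3, h4] at hl
    have hγ : (fun t : ℝ => Phi (fun x => ε * V x) t z + τ • (1 - t) • k) ∈
        curves (z.1 + τ • k) y := by
      have hz1 := (hr z hz).2.1.1
      refine ⟨hz1.1.add ?_, ?_, ?_⟩
      · have : ContDiff ℝ ∞ fun t : ℝ => τ • (1 - t) • k := by fun_prop
        exact this.contDiffOn
      · have := hz1.2.1
        simp only at this
        simp [this]
      · simp [hy, hN.endpointMap_eq]
    rw [hc, cost_eq_of_isLeastAction hl]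
    refine (hl.2 _ hγ).trans (le_of_eq ?_)
    refine action_eq hV (a := z.1 + τ • k) ?_ fun t ht => ?_
    · conv_lhs => rw [isNewton_iff.1 hN]
      rw [map_add, map_smul, affinePath_eq]
      ext1 t
      simp
      abel
    · rw [hPhi t ht, ext01_of_mem _ ht, ext01_of_mem _ ht]
      simp [affinePath_apply, sub_smul, smul_sub]
      abel
  have h0 : c (z.1 + (0 : ℝ) • k) y = a 0 := by
    have := hgen.cost_eq z hz
    simp only [ha]
    rw [add_zero_smul, add_zero_smul, zero_smul, add_zero]
    exact this
  have hmax : IsLocalMax (fun τ : ℝ => c (z.1 + τ • k) y - a τ) 0 := by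
    filter_upwards [hle] with τ hτ
    simp only [h0, sub_self]
    exact sub_nonpos.2 hτ
  have h3 := hmax.hasDerivAt_eq_zero (h1.sub h2)
  rw [inner_neg_left]
  linarith

end Generated

/-! ### Second derivatives along lines -/

/-- Passes between scalar second derivatives and the iterated Fréchet derivative, whose joint
continuity drives the perturbation argument. The functional `L` serves to evaluate at a time, to
take a matrix entry or to integrate. -/
theorem iteratedDeriv_two_line {F G : Type*} [NormedAddCommGroup F] [NormedSpace ℝ F]
    [NormedAddCommGroup G] [NormedSpace ℝ G] {f : F → G} {p : F} (hf : ContDiffAt ℝ 2 f p)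
    (v : F) (L : G →L[ℝ] ℝ) :
    iteratedDeriv 2 (fun s : ℝ => L (f (p + s • v))) 0 = L (fderiv ℝ (fderiv ℝ f) p v v) := by
  have hl : ∀ s : ℝ, HasDerivAt (fun s : ℝ => p + s • v) v s := fun s => by
    simpa using ((hasDerivAt_id s).smul_const v).const_add p
  have h0 : p + (0 : ℝ) • v = p := by simp
  have hev : ∀ᶠ s : ℝ in 𝓝 0, ContDiffAt ℝ 2 f (p + s • v) := by
    have hc : Tendsto (fun s : ℝ => p + s • v) (𝓝 0) (𝓝 p) := by
      have := (hl 0).continuousAt.tendsto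
      rwa [h0] at this
    exact hc.eventually (hf.eventually (by simp))
  have hd : deriv (fun s : ℝ => L (f (p + s • v))) =ᶠ[𝓝 0]
      fun s => L (fderiv ℝ f (p + s • v) v) := by
    filter_upwards [hev] with s hs
    exact (L.hasFDerivAt.comp_hasDerivAt s ((hs.differentiableAt (by simp)).hasFDerivAt.comp_hasDerivAt
      s (hl s))).deriv
  rw [iteratedDeriv_succ, iteratedDeriv_one, hd.deriv_eq]
  have h1 : HasFDerivAt (fderiv ℝ f) (fderiv ℝ (fderiv ℝ f) p) p :=
    ((hf.fderiv_right (m := 1) (by norm_num)).differentiableAt (by simp)).hasFDerivAt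
  have h2 := h1.comp_hasDerivAt_of_eq (0 : ℝ) (hl 0) h0.symm
  have h3 := h2.clm_apply (hasDerivAt_const (0 : ℝ) v)
  have h4 := L.hasFDerivAt.comp_hasDerivAt (0 : ℝ) h3
  refine h4.deriv.trans ?_
  simp

theorem continuousAt_second_fderiv {F G X : Type*} [NormedAddCommGroup F] [NormedSpace ℝ F]
    [NormedAddCommGroup G] [NormedSpace ℝ G] [TopologicalSpace X] {f : F → G} {a v : X → F} {x : X}
    (hf : ContDiffAt ℝ 2 f (a x)) (ha : ContinuousAt a x) (hv : ContinuousAt v x) :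
    ContinuousAt (fun x => fderiv ℝ (fderiv ℝ f) (a x) (v x) (v x)) x := by
  have h1 : ContinuousAt (fderiv ℝ (fderiv ℝ f)) (a x) :=
    ((hf.fderiv_right (m := 1) (by norm_num)).fderiv_right (m := 0) (by norm_num)).continuousAt
  exact ((h1.comp ha).clm_apply hv).clm_apply hv

/-! ### The curvature form and its stability for small `ε` -/

section Curvature

variable {n : ℕ} (V : E n → ℝ) (hV : ContDiff ℝ ∞ V)

/-- The operator `B` for which `id - ε B` is the Hessian of the cost in the first variable. -/
noncomputable def curvatureOp (p : ℝ × (E n × E n)) : E n →L[ℝ] E n :=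
  (ContinuousLinearMap.id ℝ (E n) - p.1 • remainderV V hV p).inverse ∘L
    (remainderX V hV p - remainderV V hV p)

/-- The second derivative of `⟨B u, u⟩` in the direction of the velocity `w`. -/
noncomputable def curvatureForm (p : ℝ × (E n × E n)) (u w : E n) : ℝ :=
  inner ℝ (fderiv ℝ (fderiv ℝ (curvatureOp V hV)) p (0, (0, w)) (0, (0, w)) u) u

variable {V hV}

theorem contDiffAt_fderiv_remainder {p : ℝ × (E n × E n)}
    (h : ContDiffAt ℝ 6 (newtonSol V hV) p) : ContDiffAt ℝ 3 (fderiv ℝ (remainder V hV)) p :=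
  (SolvableAt.contDiffAt_remainder h).fderiv_right (by norm_num)

theorem contDiffAt_remainderX {p : ℝ × (E n × E n)}
    (h : ContDiffAt ℝ 6 (newtonSol V hV) p) : ContDiffAt ℝ 3 (remainderX V hV) p :=
  (contDiffAt_fderiv_remainder h).clm_comp contDiffAt_const

theorem contDiffAt_remainderV {p : ℝ × (E n × E n)}
    (h : ContDiffAt ℝ 6 (newtonSol V hV) p) : ContDiffAt ℝ 3 (remainderV V hV) p :=
  (contDiffAt_fderiv_remainder h).clm_comp contDiffAt_const

theorem SolvableAt.contDiffAt_curvatureOp {p : ℝ × (E n × E n)} (h : SolvableAt V hV p) :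
    ContDiffAt ℝ 3 (curvatureOp V hV) p := by
  have hX := contDiffAt_remainderX h.contDiffAt
  have hVp := contDiffAt_remainderV h.contDiffAt
  refine ContDiffAt.clm_comp ?_ (hX.sub hVp)
  refine ContDiffAt.comp (g := ContinuousLinearMap.inverse) p ?_
    (contDiffAt_const.sub (contDiffAt_fst.smul hVp))
  exact h.isInvertible.contDiffAt_map_inverse

/-- Follows from `id - ε R_x = (id - ε R_α) - ε (R_x - R_α)`. -/
theorem SolvableAt.inverse_endpointMap {ε : ℝ} {z : E n × E n} (h : SolvableAt V hV (ε, z))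
    (u : E n) :
    (fderiv ℝ (endpointMap V hV ε) z ∘L .inr ℝ (E n) (E n)).inverse
      (fderiv ℝ (endpointMap V hV ε) z (u, 0)) = u - ε • curvatureOp V hV (ε, z) u := by
  rw [h.fderiv_endpointMap_inr, h.fderiv_endpointMap_inl, curvatureOp]
  obtain ⟨m, hm⟩ := h.isInvertible
  simp only at hm
  have h1 : u - ε • remainderX V hV (ε, z) u =
      m u - ε • (remainderX V hV (ε, z) u - remainderV V hV (ε, z) u) := by
    have : m u = u - ε • remainderV V hV (ε, z) u :=
      congrArg (fun L : E n →L[ℝ] E n => L u) hm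
    rw [this, smul_sub]
    abel
  rw [h1]
  simp only
  rw [← hm]
  simp

theorem SolvableAt.iteratedDeriv_curvatureOp {p : ℝ × (E n × E n)} (h : SolvableAt V hV p)
    (u w : E n) : iteratedDeriv 2 (fun s : ℝ =>
      inner ℝ (curvatureOp V hV (p.1, (p.2.1, p.2.2 + s • w)) u) u) 0 =
        curvatureForm V hV p u w := by
  have h1 := iteratedDeriv_two_line (h.contDiffAt_curvatureOp.of_le (by norm_num)) (0, (0, w))
    ((innerSL ℝ u).comp (ContinuousLinearMap.apply ℝ (E n) u))
  rw [curvatureForm, real_inner_comm]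
  refine Eq.trans ?_ h1
  congr 1
  funext s
  have h2 : p + s • ((0, (0, w)) : ℝ × (E n × E n)) = (p.1, (p.2.1, p.2.2 + s • w)) :=
    Prod.ext (by simp) (Prod.ext (by simp) (by simp))
  rw [real_inner_comm, h2]
  rfl

/-- In `⟨(id - ε B) u, u⟩` the identity part does not depend on `s`, so a factor `ε` splits off
exactly. What remains is still continuous at `ε = 0`. -/
theorem crossCurvature_eq_curvatureForm {ε : ℝ} {W : Set (E n × E n)} (hW : IsOpen W)
    (h : ∀ z ∈ W, SolvableAt V hV (ε, z)) (hr : ∀ z ∈ W, IsRegular (fun x => ε * V x) z)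
    {γ : ℝ → E n} (hγ : ContDiff ℝ ∞ γ) {α : E n} (α₁ : E n) (hz : (γ 0, α) ∈ W) :
    crossCurvature (cost fun x => ε * V x) ((fun z => (z.1, endpointMap V hV ε z)) '' W) γ α α₁ =
      3 / 2 * ε * curvatureForm V hV (ε, (γ 0, α)) (deriv γ 0) α₁ := by
  rw [(generatedCost hW h hr).crossCurvature_eq (fun z hz => gradX_endpointMap hW h hr hz) hγ α₁ hz]
  set u := deriv γ 0
  have hl : ContDiff ℝ 2 (fun s : ℝ => ((γ 0, α + s • α₁) : E n × E n)) := by fun_prop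
  have h0 : ((γ 0, α + (0 : ℝ) • α₁) : E n × E n) = (γ 0, α) := by simp
  have hmem : ∀ᶠ s : ℝ in 𝓝 0, ((γ 0, α + s • α₁) : E n × E n) ∈ W :=
    hl.continuous.continuousAt.eventually_mem (by rw [h0]; exact hW.mem_nhds hz)
  have heq : (fun s : ℝ => inner ℝ
      ((fderiv ℝ (endpointMap V hV ε) (γ 0, α + s • α₁) ∘L .inr ℝ (E n) (E n)).inverse
        (fderiv ℝ (endpointMap V hV ε) (γ 0, α + s • α₁) (u, 0))) u) =ᶠ[𝓝 0] fun s : ℝ =>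
      inner ℝ u u - ε * inner ℝ (curvatureOp V hV (ε, (γ 0, α + s • α₁)) u) u := by
    filter_upwards [hmem] with s hs
    rw [(h _ hs).inverse_endpointMap, inner_sub_left, real_inner_smul_left]
  have hB : ContDiffAt ℝ 2
      (fun s : ℝ => inner ℝ (curvatureOp V hV (ε, (γ 0, α + s • α₁)) u) u) 0 := by
    refine ContDiffAt.inner ℝ (ContDiffAt.clm_apply ?_ contDiffAt_const) contDiffAt_const
    refine ContDiffAt.comp (g := curvatureOp V hV) (0 : ℝ) ?_
      (contDiffAt_const.prodMk hl.contDiffAt)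
    rw [h0]
    exact (h _ hz).contDiffAt_curvatureOp.of_le (by norm_num)
  have hcf := (h _ hz).iteratedDeriv_curvatureOp u α₁
  simp only at hcf
  rw [heq.iteratedDeriv_eq,
    iteratedDeriv_fun_sub (n := 2) contDiffAt_const (contDiffAt_const.mul hB),
    iteratedDeriv_const_mul_field, hcf]
  simp [iteratedDeriv_const]
  ring

theorem curvatureForm_smul (p : ℝ × (E n × E n)) (u w : E n) (a b : ℝ) :
    curvatureForm V hV p (a • u) (b • w) = a ^ 2 * b ^ 2 * curvatureForm V hV p u w := by
  have h1 : ((0, (0, b • w)) : ℝ × (E n × E n)) = b • (0, (0, w)) := by simp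
  rw [curvatureForm, curvatureForm, h1]
  simp only [map_smul, smul_apply, real_inner_smul_left,
    real_inner_smul_right]
  ring

theorem curvatureForm_zero_right (p : ℝ × (E n × E n)) (u : E n) :
    curvatureForm V hV p u 0 = 0 := by
  simpa using curvatureForm_smul (hV := hV) p u 0 1 0

theorem eventually_solvableAt (hV : ContDiff ℝ ∞ V) (z₀ : E n × E n) :
    ∀ᶠ p in 𝓝 (0, z₀), SolvableAt V hV p := by
  obtain ⟨h1, h2⟩ := contDiffAt_newtonSol hV z₀
  -- Differentiability of finite order at a point, unlike that of order `∞`, persists in a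
  -- neighbourhood.
  have h6 : ContDiffAt ℝ 6 (newtonSol V hV) (0, z₀) := h1.of_le six_le_infty
  have h3 : ∀ᶠ p : ℝ × (E n × E n) in 𝓝 (0, z₀),
      (ContinuousLinearMap.id ℝ (E n) - p.1 • remainderV V hV p).IsInvertible := by
    have hc : ContinuousAt (fun p : ℝ × (E n × E n) =>
        ContinuousLinearMap.id ℝ (E n) - p.1 • remainderV V hV p) (0, z₀) :=
      continuousAt_const.sub (continuousAt_fst.smul (contDiffAt_remainderV h6).continuousAt)
    refine hc.eventually_mem (s := {L | L.IsInvertible}) ?_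
    have h0 : ContinuousLinearMap.id ℝ (E n) - (0 : ℝ) • remainderV V hV (0, z₀) =
        ContinuousLinearEquiv.refl ℝ (E n) := by ext1 v; simp
    simp only [h0]
    exact ContinuousLinearEquiv.nhds (ContinuousLinearEquiv.refl ℝ (E n))
  filter_upwards [h2, h6.eventually (by simp), h3] with p hp1 hp2 hp3 using ⟨hp1, hp2, hp3⟩

theorem continuousAt_curvatureForm (hV : ContDiff ℝ ∞ V) (z₀ : E n × E n) (u w : E n) :
    ContinuousAt (fun r : (ℝ × (E n × E n)) × (E n × E n) =>
      curvatureForm V hV r.1 r.2.1 r.2.2) ((0, z₀), (u, w)) := by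
  have h1 : ContDiffAt ℝ 2 (curvatureOp V hV) (0, z₀) :=
    (eventually_solvableAt hV z₀).self_of_nhds.contDiffAt_curvatureOp.of_le (by norm_num)
  have hw : ContinuousAt (fun r : (ℝ × (E n × E n)) × (E n × E n) =>
      ((0, (0, r.2.2)) : ℝ × (E n × E n))) ((0, z₀), (u, w)) := by fun_prop
  have hu : ContinuousAt (fun r : (ℝ × (E n × E n)) × (E n × E n) => r.2.1) ((0, z₀), (u, w)) := by
    fun_prop
  have h2 := continuousAt_second_fderiv (a := Prod.fst) (x := ((0, z₀), (u, w))) h1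
    continuousAt_fst hw
  exact (h2.clm_apply hu).inner (𝕜 := ℝ) hu

/-- If the curvature form is positive for `ε = 0` over a compact set, then so it is for small
`ε`, and Newton's equation is solvable. -/
theorem exists_pos_forall_curvatureForm_pos (hV : ContDiff ℝ ∞ V) {K : Set (E n × E n)}
    (hK : IsCompact K) (hpos : ∀ z ∈ K, ∀ u w : E n, u ≠ 0 → w ≠ 0 → inner ℝ u w = 0 →
      0 < curvatureForm V hV (0, z) u w) :
    ∃ ε₀ > 0, ∀ ε : ℝ, 0 < ε → ε < ε₀ → ∀ z ∈ K, SolvableAt V hV (ε, z) ∧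
      ∀ u w : E n, u ≠ 0 → w ≠ 0 → inner ℝ u w = 0 → 0 < curvatureForm V hV (ε, z) u w := by
  -- Homogeneity reduces the claim to orthonormal pairs. These form a compact set, so pointwise
  -- openness of positivity becomes uniform over `S`, and then over `K`.
  set S : Set (E n × E n) :=
    (Metric.sphere 0 1 ×ˢ Metric.sphere 0 1) ∩ {r | inner ℝ r.1 r.2 = 0} with hS
  have hSc : IsCompact S := ((isCompact_sphere 0 1).prod (isCompact_sphere 0 1)).inter_right
    (isClosed_eq (continuous_fst.inner continuous_snd) continuous_const)
  have hne : ∀ u : E n, u ∈ Metric.sphere (0 : E n) 1 → u ≠ 0 := by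
    rintro u hu rfl
    simp at hu
  have h1 : ∀ z ∈ K, ∀ᶠ p in 𝓝 ((0 : ℝ), z), SolvableAt V hV p ∧
      ∀ r ∈ S, 0 < curvatureForm V hV p r.1 r.2 := by
    intro z hz
    refine (eventually_solvableAt hV z).and ?_
    refine hSc.eventually_forall_of_forall_eventually fun r hr => ?_
    exact (continuousAt_curvatureForm hV z r.1 r.2).eventually_const_lt
      (hpos z hz _ _ (hne _ hr.1.1) (hne _ hr.1.2) hr.2)
  have h2 : ∀ᶠ ε in 𝓝 (0 : ℝ), ∀ z ∈ K, SolvableAt V hV (ε, z) ∧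
      ∀ r ∈ S, 0 < curvatureForm V hV (ε, z) r.1 r.2 :=
    hK.eventually_forall_of_forall_eventually h1
  obtain ⟨ε₀, hε₀, h3⟩ := Metric.eventually_nhds_iff.1 h2
  refine ⟨ε₀, hε₀, fun ε hε hlt z hz => ?_⟩
  obtain ⟨h4, h5⟩ := h3 (by rw [Real.dist_eq, sub_zero, abs_of_pos hε]; exact hlt) z hz
  refine ⟨h4, fun u w hu hw huw => ?_⟩
  have hu' := norm_pos_iff.2 hu
  have hw' := norm_pos_iff.2 hw
  have h6 := h5 (‖u‖⁻¹ • u, ‖w‖⁻¹ • w) ⟨⟨by simp [norm_smul, hu'.ne'], by simp [norm_smul, hw'.ne']⟩,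
    by simp [real_inner_smul_left, real_inner_smul_right, huw]⟩
  rw [curvatureForm_smul] at h6
  exact pos_of_mul_pos_right h6 (by positivity)

/-- The strong Ma-Trudinger-Wang condition from positivity of the curvature form. -/
theorem strongMTW_of_curvatureForm_pos {ε : ℝ} (hε : 0 < ε) {W : Set (E n × E n)} (hW : IsOpen W)
    (h : ∀ z ∈ W, SolvableAt V hV (ε, z) ∧ ∀ u w : E n, u ≠ 0 → w ≠ 0 → inner ℝ u w = 0 →
      0 < curvatureForm V hV (ε, z) u w)
    (hr : ∀ z ∈ W, IsRegular (fun x => ε * V x) z) :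
    StrongMTW (cost fun x => ε * V x) (endpoints (fun x => ε * V x) W) := by
  have hs := fun z hz => (h z hz).1
  have hend : endpoints (fun x => ε * V x) W = (fun z => (z.1, endpointMap V hV ε z)) '' W := by
    refine image_congr fun z hz => ?_
    rw [(hs z hz).isNewton.endpointMap_eq]
  have hgrad := fun z hz => gradX_endpointMap hW hs hr (z := z) hz
  rw [hend]
  refine ⟨(generatedCost hW hs hr).nondegenerate hgrad, fun γ hγ α α₁ hdom horth => ?_,
    fun γ hγ α α₁ hdom horth hzero => ?_⟩
  · have hz := GeneratedCost.mem_of_mem_cExpDomain hgrad hdom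
    rw [crossCurvature_eq_curvatureForm hW hs hr hγ α₁ hz]
    by_cases h1 : deriv γ 0 = 0
    · simp [curvatureForm, h1]
    by_cases h2 : α₁ = 0
    · simp [h2, curvatureForm_zero_right]
    have := (h _ hz).2 _ _ h1 h2 (by rw [real_inner_comm]; exact horth)
    positivity
  · have hz := GeneratedCost.mem_of_mem_cExpDomain hgrad hdom
    rw [crossCurvature_eq_curvatureForm hW hs hr hγ α₁ hz] at hzero
    by_contra! hne
    have := (h _ hz).2 _ _ hne.1 hne.2 (by rw [real_inner_comm]; exact horth)
    have : 0 < 3 / 2 * ε * curvatureForm V hV (ε, (γ 0, α)) (deriv γ 0) α₁ := by positivity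
    exact this.ne' hzero

end Curvature

theorem two_le_infty : (2 : ℕ∞ω) ≤ ∞ :=
  WithTop.coe_le_coe.2 (le_top : (2 : ℕ∞) ≤ ⊤)

theorem bilin_smul_smul {F : Type*} [NormedAddCommGroup F] [NormedSpace ℝ F]
    (L : F →L[ℝ] F →L[ℝ] ℝ) (t : ℝ) (w : F) : L (t • w) (t • w) = t ^ 2 * L w w := by
  simp only [map_smul, smul_apply, smul_eq_mul]
  ring

/-! ### The curvature form at `ε = 0` -/

section Unperturbed

variable {n : ℕ} {V : E n → ℝ}

/-- The fourth derivative of `V` in the directions `u, u, w, w`. -/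
noncomputable def fourthDeriv (V : E n → ℝ) (u w x : E n) : ℝ :=
  iteratedDeriv 2 (fun b : ℝ => iteratedDeriv 2 (fun a : ℝ => V (x + b • w + a • u)) 0) 0

/-- The Hessian of `V` in the direction `u`. -/
noncomputable def hessMap (V : E n → ℝ) (hV : ContDiff ℝ ∞ V) (u : E n) : C(E n, ℝ) :=
  ⟨fun x => inner ℝ (fderiv ℝ (gradient V) x u) u,
    ((((contDiff_gradient hV).continuous_fderiv (by simp)).clm_apply continuous_const).inner
      continuous_const)⟩

theorem contDiff_hessMap (hV : ContDiff ℝ ∞ V) (u : E n) : ContDiff ℝ ∞ (hessMap V hV u) :=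
  (((contDiff_gradient hV).fderiv_right (m := ∞) (by simp)).clm_apply contDiff_const).inner ℝ
    contDiff_const

theorem hessMap_eq (hV : ContDiff ℝ ∞ V) (u x : E n) :
    hessMap V hV u x = iteratedDeriv 2 (fun a : ℝ => V (x + a • u)) 0 := by
  have h1 := iteratedDeriv_two_line (hV.contDiffAt (x := x) |>.of_le two_le_infty) u
    (ContinuousLinearMap.id ℝ ℝ)
  simp only [ContinuousLinearMap.id_apply] at h1
  rw [h1]
  have h2 : HasFDerivAt (fun x => fderiv ℝ V x u) (fderiv ℝ (fderiv ℝ V) x |>.flip u) x := by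
    have := ((hV.fderiv_right (m := ∞) (by simp)).differentiable (by simp) x).hasFDerivAt.clm_apply
      (hasFDerivAt_const u x)
    simpa using this
  have h3 : HasFDerivAt (fun x => inner ℝ (gradient V x) u) _ x :=
    ((contDiff_gradient hV).differentiable (by simp) x).hasFDerivAt.inner ℝ (hasFDerivAt_const u x)
  have h4 : (fun x => inner ℝ (gradient V x) u) = fun x => fderiv ℝ V x u :=
    funext fun x => inner_gradient_left
  rw [h4] at h3
  have h5 := congrArg (fun L : E n →L[ℝ] ℝ => L u) (h3.unique h2)
  simpa [hessMap, fderivInnerCLM_apply] using h5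

theorem fourthDeriv_eq (hV : ContDiff ℝ ∞ V) (u w x : E n) :
    fourthDeriv V u w x = fderiv ℝ (fderiv ℝ (hessMap V hV u)) x w w := by
  have h1 := iteratedDeriv_two_line ((contDiff_hessMap hV u).contDiffAt (x := x) |>.of_le two_le_infty)
    w (ContinuousLinearMap.id ℝ ℝ)
  simp only [ContinuousLinearMap.id_apply, hessMap_eq] at h1
  exact h1

theorem inner_integral01_primitive (φ : C(I01, E n)) (u : E n) :
    inner ℝ (integral01 (E n) (primitive (E n) φ)) u =
      integral01 ℝ (primitive ℝ (((innerSL ℝ u).compLeftContinuous ℝ I01) φ)) := by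
  have h1 : ∀ (ψ : C(I01, E n)) (a b : ℝ), innerSL ℝ u (∫ s in a..b, ext01 ψ s) =
      ∫ s in a..b, ext01 ((innerSL ℝ u).compLeftContinuous ℝ I01 ψ) s := fun ψ a b =>
    ((innerSL ℝ u).intervalIntegral_comp_comm
      ((continuous_ext01 ψ).intervalIntegrable a b)).symm
  have h2 : (innerSL ℝ u).compLeftContinuous ℝ I01 (primitive (E n) φ) =
      primitive ℝ ((innerSL ℝ u).compLeftContinuous ℝ I01 φ) := by
    ext1 t
    exact h1 φ 0 t
  rw [← h2, real_inner_comm]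
  exact h1 _ 0 1

theorem integral01_pos {φ : C(I01, ℝ)} (h : ∀ t : I01, 0 < (t : ℝ) → (t : ℝ) < 1 → 0 < φ t) :
    0 < integral01 ℝ φ := by
  rw [integral01_apply]
  refine intervalIntegral.intervalIntegral_pos_of_pos_on
    ((continuous_ext01 φ).intervalIntegrable _ _) (fun t ht => ?_) zero_lt_one
  rw [ext01_of_mem _ (Ioo_subset_Icc_self ht)]
  exact h _ ht.1 ht.2

theorem primitive_pos {φ : C(I01, ℝ)} (h : ∀ t : I01, 0 < (t : ℝ) → (t : ℝ) < 1 → 0 < φ t)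
    (t : I01) (ht : 0 < (t : ℝ)) : 0 < primitive ℝ φ t := by
  rw [primitive_apply]
  refine intervalIntegral.intervalIntegral_pos_of_pos_on
    ((continuous_ext01 φ).intervalIntegrable _ _) (fun s hs => ?_) ht
  have hs1 : s < 1 := hs.2.trans_le t.2.2
  rw [ext01_of_mem _ ⟨hs.1.le, hs1.le⟩]
  exact h _ hs.1 hs1

/-- The functional `φ ↦ ∫₀¹ ∫₀ᵗ (1 - s) φ(s) ds dt`. -/
noncomputable def weightedIntegral : C(I01, ℝ) →L[ℝ] ℝ :=
  integral01 ℝ ∘L primitive ℝ ∘L pointwiseApply I01 ℝ ℝ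
    ⟨fun t => (1 - (t : ℝ)) • ContinuousLinearMap.id ℝ ℝ, by fun_prop⟩

theorem weightedIntegral_pos {φ : C(I01, ℝ)} (h : ∀ t : I01, 0 < (t : ℝ) → (t : ℝ) < 1 → 0 < φ t) :
    0 < weightedIntegral φ := by
  refine integral01_pos fun t ht _ => primitive_pos (fun t ht0 ht1 => ?_) t ht
  simpa using mul_pos (sub_pos.2 ht1) (h t ht0 ht1)

/-- At `ε = 0` the operator `B = R_x - R_α` is the derivative of the remainder in the direction `(u,
-u)`. This moves the line `x + t α` by `(1 - t) u`, which is the source of the weight. -/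
theorem inner_curvatureOp_zero (hV : ContDiff ℝ ∞ V) (z : E n × E n) (u : E n) :
    inner ℝ (curvatureOp V hV (0, z) u) u =
      weightedIntegral ((hessMap V hV u).comp (affinePath n z)) := by
  have h1 : curvatureOp V hV (0, z) u = fderiv ℝ (remainder V hV) (0, z) (0, (u, -u)) := by
    have h2 : ((0, (u, -u)) : ℝ × (E n × E n)) = (0, (u, 0)) - (0, (0, u)) := by simp
    have h3 : ContinuousLinearMap.id ℝ (E n) - ((0, z) : ℝ × (E n × E n)).1 •
        remainderV V hV (0, z) = ContinuousLinearMap.id ℝ (E n) := by ext1 v; simp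
    rw [curvatureOp, h3, ContinuousLinearMap.inverse_id, h2, map_sub]
    simp [remainderX, remainderV]
  have hs := (eventually_solvableAt hV z).self_of_nhds
  have h4 := HasFDerivAt.comp (g := remainder V hV) (f := fun z => ((0 : ℝ), z)) z
    ((SolvableAt.contDiffAt_remainder hs.contDiffAt).differentiableAt (by simp)).hasFDerivAt
    (hasFDerivAt_prodMk_right (0 : ℝ) z)
  let g' : C(E n, E n →L[ℝ] E n) := ⟨fderiv ℝ (gradient V),
    (contDiff_gradient hV).continuous_fderiv (by simp)⟩
  have h5 : HasFDerivAt (fun z => (gradientMap V hV).comp (affinePath n z))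
      (pointwiseApply I01 (E n) (E n) (g'.comp (affinePath n z)) ∘L affinePath n) z :=
    HasFDerivAt.comp z (hasFDerivAt_superposition (K := I01) (gradientMap V hV) g'
      (fun x => ((contDiff_gradient hV).differentiable (by simp) x).hasFDerivAt) (affinePath n z))
      (affinePath n).hasFDerivAt
  have h6 := (integral01 (E n) ∘L primitive (E n)).hasFDerivAt.comp z h5
  have h7 : remainder V hV ∘ (fun z => ((0 : ℝ), z)) =
      (integral01 (E n) ∘L primitive (E n)) ∘
        fun z => (gradientMap V hV).comp (affinePath n z) := by
    funext z
    simp only [Function.comp_apply, remainder, newtonSol_zero]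
    rfl
  rw [h7] at h4
  have h8 := congrArg (fun L : E n × E n →L[ℝ] E n => L (u, -u)) (h4.unique h6)
  have h9 : fderiv ℝ (remainder V hV) (0, z) (0, (u, -u)) = integral01 (E n) (primitive (E n)
    (pointwiseApply I01 (E n) (E n) (g'.comp (affinePath n z)) (affinePath n (u, -u)))) := h8
  rw [h1, h9, inner_integral01_primitive]
  refine congrArg (fun φ => integral01 ℝ (primitive ℝ φ)) ?_
  ext1 t
  have h10 : affinePath n (u, -u) t = (1 - (t : ℝ)) • u := by
    rw [affinePath_apply, sub_smul, one_smul, smul_neg, sub_eq_add_neg]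
  change inner ℝ u (g' (affinePath n z t) (affinePath n (u, -u) t)) =
    (1 - (t : ℝ)) • inner ℝ (g' (affinePath n z t) u) u
  rw [h10, map_smul, real_inner_smul_right, real_inner_comm]
  rfl

/-- Shifting `α` by `s w` moves the line by `s t w`, so the second derivative in `s` brings out `t²
D⁴V(u, u, w, w)` under the integral. -/
theorem curvatureForm_zero_pos (hV : ContDiff ℝ ∞ V) (z : E n × E n) (u w : E n)
    (h : ∀ t ∈ Icc (0 : ℝ) 1, 0 < fourthDeriv V u w (z.1 + t • z.2)) :
    0 < curvatureForm V hV (0, z) u w := by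
  have hs := (eventually_solvableAt hV z).self_of_nhds
  rw [← hs.iteratedDeriv_curvatureOp u w]
  simp only [inner_curvatureOp_zero]
  set F : C(I01, E n) → C(I01, ℝ) := fun q => (hessMap V hV u).comp q with hF
  have hFc : ContDiff ℝ ∞ F := contDiff_superposition _ (contDiff_hessMap hV u)
  set a := affinePath n z with ha
  set v := affinePath n (0, w) with hv
  have hline : ∀ s : ℝ, affinePath n (z.1, z.2 + s • w) = a + s • v := fun s => by
    rw [ha, hv, ← map_smul, ← map_add]
    congr 1
    exact Prod.ext (by simp) (by simp)
  have h1 := iteratedDeriv_two_line (hFc.contDiffAt (x := a) |>.of_le two_le_infty) v weightedIntegral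
  simp only [hline]
  refine lt_of_lt_of_eq (weightedIntegral_pos fun t ht0 ht1 => ?_) h1.symm
  -- Evaluation at `t` turns the second derivative of the superposition operator into that of the
  -- Hessian entry at the point `a t`.
  have h2 := iteratedDeriv_two_line (hFc.contDiffAt (x := a) |>.of_le two_le_infty) v
    (ContinuousMap.evalCLM ℝ t)
  have h3 := iteratedDeriv_two_line ((contDiff_hessMap hV u).contDiffAt (x := a t) |>.of_le
    two_le_infty) (v t) (ContinuousLinearMap.id ℝ ℝ)
  have h4 : fderiv ℝ (fderiv ℝ F) a v v t = fderiv ℝ (fderiv ℝ (hessMap V hV u)) (a t) (v t) (v t) :=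
    h2.symm.trans h3
  have h5 : v t = (t : ℝ) • w := by simp [hv, affinePath_apply]
  rw [h4, h5]
  rw [bilin_smul_smul, ← fourthDeriv_eq, ha, affinePath_apply]
  have := h t t.2
  positivity

end Unperturbed

/-! ### Radial potentials and the conclusion -/

section Radial

variable {n : ℕ}

theorem contDiff_radial {f : ℝ → ℝ} (hf : ContDiffOn ℝ ∞ f (Ici 0)) :
    ContDiff ℝ ∞ (fun x : E n => f (‖x‖ ^ 2 / 2)) := by
  rw [← contDiffOn_univ]
  exact hf.comp ((contDiff_norm_sq ℝ).div_const 2).contDiffOn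
    (fun x _ => by simp only [mem_Ici]; positivity)

/-- Chain rule for `s(b) = |x + b v|² / 2`, with `s' = ⟨x + b v, v⟩` and `s'' = |v|²`. As `s ≥ 0`,
derivatives of `φ` within `[0, ∞)` suffice, even where `s = 0`. -/
theorem iteratedDeriv_radial_line {φ : ℝ → ℝ} (hφ : ContDiffOn ℝ ∞ φ (Ici 0)) (x v : E n) :
    iteratedDeriv 2 (fun b : ℝ => φ (‖x + b • v‖ ^ 2 / 2)) 0 =
      iteratedDerivWithin 2 φ (Ici 0) (‖x‖ ^ 2 / 2) * inner ℝ x v ^ 2 +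
        derivWithin φ (Ici 0) (‖x‖ ^ 2 / 2) * ‖v‖ ^ 2 := by
  have hs : ∀ b : ℝ, HasDerivAt (fun b : ℝ => ‖x + b • v‖ ^ 2 / 2) (inner ℝ (x + b • v) v) b := by
    intro b
    have h1 : HasDerivAt (fun b : ℝ => x + b • v) v b := by
      simpa using ((hasDerivAt_id b).smul_const v).const_add x
    have h2 := h1.norm_sq.div_const 2
    refine h2.congr_deriv ?_
    ring
  have hmem : ∀ b : ℝ, ‖x + b • v‖ ^ 2 / 2 ∈ Ici (0 : ℝ) := fun b => by
    simp only [mem_Ici]; positivity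
  have hchain : ∀ ψ : ℝ → ℝ, ContDiffOn ℝ ∞ ψ (Ici 0) → ∀ b : ℝ,
      HasDerivAt (fun b : ℝ => ψ (‖x + b • v‖ ^ 2 / 2))
        (derivWithin ψ (Ici 0) (‖x + b • v‖ ^ 2 / 2) * inner ℝ (x + b • v) v) b := by
    intro ψ hψ b
    exact HasDerivWithinAt.comp_hasDerivAt b
      ((hψ.differentiableOn (by simp) _ (hmem b)).hasDerivWithinAt) (hs b)
      (Eventually.of_forall hmem)
  have hφ' : ContDiffOn ℝ ∞ (derivWithin φ (Ici 0)) (Ici 0) :=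
    hφ.derivWithin (uniqueDiffOn_Ici 0) (by simp)
  rw [iteratedDeriv_succ, iteratedDeriv_one, funext fun b => (hchain φ hφ b).deriv]
  have h3 : HasDerivAt (fun b : ℝ => inner ℝ (x + b • v) v) (‖v‖ ^ 2) 0 := by
    have h1 : HasDerivAt (fun b : ℝ => x + b • v) v 0 := by
      simpa using ((hasDerivAt_id (0 : ℝ)).smul_const v).const_add x
    simpa using h1.inner ℝ (hasDerivAt_const (0 : ℝ) v)
  refine ((hchain _ hφ' 0).mul h3).deriv.trans ?_
  rw [iteratedDerivWithin_succ, iteratedDerivWithin_one]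
  simp
  ring

/-- Orthogonality makes `⟨x + b w, u⟩` constant in `b`, so the outer derivative acts only on `f'`
and `f''`, and the formula along a line applies to each. -/
theorem fourthDeriv_radial {f : ℝ → ℝ} (hf : ContDiffOn ℝ ∞ f (Ici 0)) {u w : E n}
    (huw : inner ℝ u w = 0) (x : E n) :
    fourthDeriv (fun x : E n => f (‖x‖ ^ 2 / 2)) u w x =
      (iteratedDerivWithin 4 f (Ici 0) (‖x‖ ^ 2 / 2) * inner ℝ x w ^ 2 +
        iteratedDerivWithin 3 f (Ici 0) (‖x‖ ^ 2 / 2) * ‖w‖ ^ 2) * inner ℝ x u ^ 2 +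
      (iteratedDerivWithin 3 f (Ici 0) (‖x‖ ^ 2 / 2) * inner ℝ x w ^ 2 +
        iteratedDerivWithin 2 f (Ici 0) (‖x‖ ^ 2 / 2) * ‖w‖ ^ 2) * ‖u‖ ^ 2 := by
  have hwu : inner ℝ w u = 0 := by rw [real_inner_comm]; exact huw
  have hu := uniqueDiffOn_Ici (0 : ℝ)
  have hf1 : ContDiffOn ℝ ∞ (derivWithin f (Ici 0)) (Ici 0) := hf.derivWithin hu (by simp)
  have hf2 : ContDiffOn ℝ ∞ (iteratedDerivWithin 2 f (Ici 0)) (Ici 0) := by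
    have : iteratedDerivWithin 2 f (Ici 0) = derivWithin (derivWithin f (Ici 0)) (Ici 0) := by
      rw [iteratedDerivWithin_succ, iteratedDerivWithin_one]
    rw [this]
    exact hf1.derivWithin hu (by simp)
  have hline : ContDiff ℝ ∞ fun b : ℝ => x + b • w := by fun_prop
  have hc1 : ContDiffAt ℝ 2 (fun b : ℝ => derivWithin f (Ici 0) (‖x + b • w‖ ^ 2 / 2)) 0 :=
    (((contDiff_radial hf1).comp hline).of_le two_le_infty).contDiffAt
  have hc2 : ContDiffAt ℝ 2
      (fun b : ℝ => iteratedDerivWithin 2 f (Ici 0) (‖x + b • w‖ ^ 2 / 2)) 0 :=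
    (((contDiff_radial hf2).comp hline).of_le two_le_infty).contDiffAt
  have h1 : (fun b : ℝ => iteratedDeriv 2
      (fun a : ℝ => f (‖x + b • w + a • u‖ ^ 2 / 2)) 0) = fun b : ℝ =>
      inner ℝ x u ^ 2 * iteratedDerivWithin 2 f (Ici 0) (‖x + b • w‖ ^ 2 / 2) +
        ‖u‖ ^ 2 * derivWithin f (Ici 0) (‖x + b • w‖ ^ 2 / 2) := by
    funext b
    rw [iteratedDeriv_radial_line hf, inner_add_left, real_inner_smul_left, hwu]
    ring
  rw [fourthDeriv, h1, iteratedDeriv_fun_add (n := 2) (contDiffAt_const.mul hc2)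
    (contDiffAt_const.mul hc1), iteratedDeriv_const_mul_field, iteratedDeriv_const_mul_field,
    iteratedDeriv_radial_line hf1, iteratedDeriv_radial_line hf2]
  simp only [iteratedDerivWithin_succ, iteratedDerivWithin_zero]
  ring

theorem fourthDeriv_radial_pos {f : ℝ → ℝ} (hf : ContDiffOn ℝ ∞ f (Ici 0)) {x : E n}
    (h2 : 0 < iteratedDerivWithin 2 f (Ici 0) (‖x‖ ^ 2 / 2))
    (h3 : 0 ≤ iteratedDerivWithin 3 f (Ici 0) (‖x‖ ^ 2 / 2))
    (h4 : 0 ≤ iteratedDerivWithin 4 f (Ici 0) (‖x‖ ^ 2 / 2))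
    {u w : E n} (hu : u ≠ 0) (hw : w ≠ 0) (huw : inner ℝ u w = 0) :
    0 < fourthDeriv (fun x : E n => f (‖x‖ ^ 2 / 2)) u w x := by
  rw [fourthDeriv_radial hf huw]
  have := norm_pos_iff.2 hu
  have := norm_pos_iff.2 hw
  positivity

theorem perturbedStrongMTW {f : ℝ → ℝ} (hf : ContDiffOn ℝ ∞ f (Ici 0)) {U : Set (E n × E n)}
    (hU : IsOpen U) (hb : Bornology.IsBounded U) {C : ℝ} (hC : 0 < C)
    (h : ∀ x v : E n, (x, v) ∈ U → ∀ t ∈ Icc (0 : ℝ) 1,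
      C ≤ iteratedDerivWithin 2 f (Ici 0) (‖x + t • v‖ ^ 2 / 2) ∧
      0 ≤ iteratedDerivWithin 3 f (Ici 0) (‖x + t • v‖ ^ 2 / 2) ∧
      0 ≤ iteratedDerivWithin 4 f (Ici 0) (‖x + t • v‖ ^ 2 / 2)) :
    PerturbedStrongMTW f U := by
  have hV := contDiff_radial (n := n) hf
  -- The conditions on the derivatives of `f` are closed, so they extend to the closure of `U`,
  -- which is compact. The uniform `C` keeps `f''` positive there.
  have hcl : ∀ z ∈ closure U, ∀ t ∈ Icc (0 : ℝ) 1,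
      C ≤ iteratedDerivWithin 2 f (Ici 0) (‖z.1 + t • z.2‖ ^ 2 / 2) ∧
      0 ≤ iteratedDerivWithin 3 f (Ici 0) (‖z.1 + t • z.2‖ ^ 2 / 2) ∧
      0 ≤ iteratedDerivWithin 4 f (Ici 0) (‖z.1 + t • z.2‖ ^ 2 / 2) := by
    intro z hz t ht
    have hcont : ∀ m : ℕ, Continuous fun z : E n × E n =>
        iteratedDerivWithin m f (Ici 0) (‖z.1 + t • z.2‖ ^ 2 / 2) := fun m =>
      (hf.continuousOn_iteratedDerivWithin (by exact_mod_cast le_top)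
        (uniqueDiffOn_Ici 0)).comp_continuous (by fun_prop)
        (fun z => by simp only [mem_Ici]; positivity)
    have hclosed : IsClosed {z : E n × E n |
        C ≤ iteratedDerivWithin 2 f (Ici 0) (‖z.1 + t • z.2‖ ^ 2 / 2) ∧
        0 ≤ iteratedDerivWithin 3 f (Ici 0) (‖z.1 + t • z.2‖ ^ 2 / 2) ∧
        0 ≤ iteratedDerivWithin 4 f (Ici 0) (‖z.1 + t • z.2‖ ^ 2 / 2)} :=
      (isClosed_le continuous_const (hcont 2)).inter
        ((isClosed_le continuous_const (hcont 3)).inter (isClosed_le continuous_const (hcont 4)))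
    exact closure_minimal (fun z hz => h z.1 z.2 hz t ht) hclosed hz
  obtain ⟨ε₀, hε₀, hgood⟩ := exists_pos_forall_curvatureForm_pos hV hb.isCompact_closure
    (fun z hz u w hu hw huw => curvatureForm_zero_pos hV z u w fun t ht => by
      obtain ⟨h2, h3, h4⟩ := hcl z hz t ht
      exact fourthDeriv_radial_pos hf (hC.trans_le h2) h3 h4 hu hw huw)
  exact ⟨ε₀, hε₀, fun ε hε hlt Uε hUε hreg =>
    strongMTW_of_curvatureForm_pos (V := fun x : E n => f (‖x‖ ^ 2 / 2)) (hV := hV) hε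
      (hUε.inter hU) (fun z hz => hgood ε hε hlt z (subset_closure hz.2))
      (fun z hz => (hreg z hz.1).1)⟩

/-- The strict bound `s < a` makes `f` agree with the square on a whole relative neighbourhood of
`s` in `[0, ∞)`. -/
theorem iteratedDerivWithin_sq {f : ℝ → ℝ} {a s : ℝ} (hf : ∀ s ∈ Icc (0 : ℝ) a, f s = s ^ 2)
    (hs : 0 ≤ s) (hsa : s < a) : iteratedDerivWithin 2 f (Ici 0) s = 2 ∧
      iteratedDerivWithin 3 f (Ici 0) s = 0 ∧ iteratedDerivWithin 4 f (Ici 0) s = 0 := by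
  have heq : f =ᶠ[𝓝[Ici 0] s] fun s => s ^ 2 := by
    filter_upwards [self_mem_nhdsWithin, mem_nhdsWithin_of_mem_nhds (Iio_mem_nhds hsa)]
      with r hr hra using hf r ⟨hr, le_of_lt hra⟩
  have hm : ∀ m : ℕ, iteratedDerivWithin m f (Ici 0) s =
      iteratedDeriv m (fun s : ℝ => s ^ 2) s := fun m => by
    rw [heq.iteratedDerivWithin_eq (hf s ⟨hs, hsa.le⟩),
      iteratedDerivWithin_eq_iteratedDeriv (uniqueDiffOn_Ici 0) (by fun_prop) hs]
  simp only [hm, iteratedDeriv_eq_iterate, iter_deriv_pow]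
  norm_num [Finset.prod_range_succ]

theorem perturbedStrongMTW_anharmonic {K : ℝ} {f : ℝ → ℝ}
    (hf : ContDiffOn ℝ ∞ f (Ici 0)) (hfs : ∀ s ∈ Icc (0 : ℝ) (K ^ 2 / 2), f s = s ^ 2) :
    PerturbedStrongMTW f {z : E n × E n | ‖z.1‖ + ‖z.2‖ < K} := by
  refine perturbedStrongMTW hf (isOpen_lt (by fun_prop) continuous_const) ?_ two_pos
    fun x v hxv t ht => ?_
  · refine (Metric.isBounded_ball (x := (0 : E n × E n)) (r := K)).subset fun z hz => ?_
    have hz' : ‖z.1‖ + ‖z.2‖ < K := hz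
    rw [mem_ball_zero_iff, Prod.norm_def, max_lt_iff]
    constructor <;> linarith [norm_nonneg z.1, norm_nonneg z.2]
  · have hxv' : ‖x‖ + ‖v‖ < K := hxv
    have h1 : ‖x + t • v‖ < K := by
      refine (norm_add_le _ _).trans_lt (lt_of_le_of_lt ?_ hxv')
      rw [norm_smul, Real.norm_eq_abs, abs_of_nonneg ht.1]
      gcongr
      exact mul_le_of_le_one_left (norm_nonneg v) ht.2
    have h2 : ‖x + t • v‖ ^ 2 / 2 < K ^ 2 / 2 := by gcongr
    obtain ⟨h3, h4, h5⟩ := iteratedDerivWithin_sq hfs (by positivity) h2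
    exact ⟨h3.ge, h4.ge, h5.ge⟩

end Radial

end MechMTW

theorem theorem6p1 (n : ℕ) :
    (∀ f : ℝ → ℝ, ContDiffOn ℝ ∞ f (Set.Ici 0) → BddAbove (f '' Set.Ici 0) →
      ∀ U : Set (MechMTW.E n × MechMTW.E n), IsOpen U → Bornology.IsBounded U →
      ∀ C : ℝ, 0 < C →
      (∀ x v : MechMTW.E n, (x, v) ∈ U → ∀ t ∈ Set.Icc (0 : ℝ) 1,
        C ≤ iteratedDerivWithin 2 f (Set.Ici 0) (‖x + t • v‖ ^ 2 / 2) ∧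
        0 ≤ iteratedDerivWithin 3 f (Set.Ici 0) (‖x + t • v‖ ^ 2 / 2) ∧
        0 ≤ iteratedDerivWithin 4 f (Set.Ici 0) (‖x + t • v‖ ^ 2 / 2)) →
      MechMTW.PerturbedStrongMTW f U) ∧
    (∀ K : ℝ, 0 < K → ∀ f : ℝ → ℝ, ContDiffOn ℝ ∞ f (Set.Ici 0) → BddAbove (f '' Set.Ici 0) →
      (∀ s ∈ Set.Icc (0 : ℝ) (K ^ 2 / 2), f s = s ^ 2) →
      MechMTW.PerturbedStrongMTW f {z : MechMTW.E n × MechMTW.E n | ‖z.1‖ + ‖z.2‖ < K}) :=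
  ⟨fun _ hf _ _ hU hb _ hC h => MechMTW.perturbedStrongMTW hf hU hb hC h,
    fun _ _ _ hf _ hfs => MechMTW.perturbedStrongMTW_anharmonic hf hfs⟩
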